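/- **Processes.** Fix countably many channels $a,b,\dots$, variables $x,y,\dots$ and process variables $X,Y,\dots$; polarities are $p,q\in\{+,-\}$, with $\overline{+}=-$ and $\overline{-}=+$. An *endpoint* is $a^p$; a *name* $u,v$ is a variable or an endpoint. *Indices* $\iota$ range over $\mathbb N\cup\{\infty\}$, with $\infty+1=\infty$. Processes are $$P ::= \mathbf 0 \mid X \mid u?(x).P \mid u!v.P \mid P\,|\,Q \mid (\nu a)P \mid \mathsf{rec}^{\iota}X.P,$$ taken up to renaming of bound names; $u?(x).P$ binds $x$, $(\nu a)P$ binds both $a^+$ and $a^-$, and $\mathsf{rec}^\iota X.P$ binds $X$. All substitutions are capture-avoiding. *Structural congruence* $\equiv$ is the least congruence with $\mathbf 0|P\equiv P$, $P|Q\equiv Q|P$, $P|(Q|R)\equiv(P|Q)|R$, $(\nu a)(\nu b)P\equiv(\nu b)(\nu a)P$, and $(\nu a)P\,|\,Q\equiv(\nu a)(P|Q)$ if $a^+,a^-$ are not free in $Q$. *Reduction* $\to$ is the least relation that contains $$a^p!c^q.P\;|\;a^{\overline p}?(x).Q\to P\,|\,Q\{c^q/x\},\qquad \mathsf{rec}^{\iota+1}X.P\to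 P\{\mathsf{rec}^{\iota}X.P/X\}$$ and is closed under restriction, parallel composition and $\equiv$ on both sides. $P\to^*Q$ means that $P$ reaches $Q$ in finitely many (possibly zero) reductions, processes being read up to $\equiv$. A *user process* is one in which all recursions carry the index $\infty$; its *$0$-approximant* $\lfloor P\rfloor_0$ is obtained by turning every $\mathsf{rec}^\infty$ into $\mathsf{rec}^0$. **Progress.** $P$ *has progress* if for all $\tilde a,a,p,c,q,P',Q$ (with $x$ a bound variable): 1. $P\to^*(\nu\tilde a)(a^p!c^q.P'\,|\,Q)$ implies $Q\to^*(\nu\tilde b)(a^{\overline p}?(x).Q'\,|\,R)$ for some $\tilde b,Q',R$ such that $a$ does not occur in $\tilde b$; 2. $P\to^*(\nu\tilde a)(a^p?(x).P'\,|\,Q)$ implies $Q\to^*(\nu\tilde b)(a^{\overline p}!d^r.Q'\,|\,R)$ for some $\tilde b,d,r,Q',R$ such that $a$ does not occur in $\tilde b$. **Session types.** With priorities $\alpha,\beta\in\mathbb N$, $$T ::= \mathsf{end}\mid t\mid {?}[\alpha,\beta]S.T\mid {!}[\alpha,\beta]S.T\mid \mathsf{rec}^{\iota}t.T,$$ up to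 renaming of bound type variables, restricted to types with no subterm $\mathsf{rec}^{\iota_1}t_1\cdots\mathsf{rec}^{\iota_n}t_n.t_1$ ($n\ge1$) and whose message types $S$ are closed. *Duality* $\bowtie$ is the least relation such that: $\mathsf{end}\bowtie\mathsf{end}$; $t\bowtie t$; if $T\bowtie T'$ then ${?}[\alpha,\beta]S.T\bowtie{!}[\beta,\alpha]S.T'$ and ${!}[\alpha,\beta]S.T\bowtie{?}[\beta,\alpha]S.T'$; if $T\bowtie S$ then $\mathsf{rec}^\iota t.T\bowtie\mathsf{rec}^\iota t.S$; if $T\bowtie\mathsf{rec}^{\iota+1}t.S$ then $T\bowtie S\{\mathsf{rec}^\iota t.S/t\}$; and if $\mathsf{rec}^{\iota+1}t.S\bowtie T$ then $S\{\mathsf{rec}^\iota t.S/t\}\bowtie T$. **Typing.** In $\Sigma;\Gamma;\Delta\vdash_\kappa P$, the finite maps $\Sigma,\Gamma,\Delta$ assign to type variables elements of $\mathbb N\cup\{\infty\}$, to process variables name environments, and to names session types. A comma joins environments with disjoint domains. The *obligation* is $\mathrm{ob}_\Sigma(\mathsf{end})=\infty$, $\mathrm{ob}_\Sigma(t)=\Sigma(t)$,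 $\mathrm{ob}_\Sigma({?}[\alpha,\beta]S.T)=\mathrm{ob}_\Sigma({!}[\alpha,\beta]S.T)=\alpha$, $\mathrm{ob}_\Sigma(\mathsf{rec}^\iota t.T)=\mathrm{ob}_\Sigma(T)$. Write $\beta<\mathrm{ob}_\Sigma(\Delta)$ if $\beta<\mathrm{ob}_\Sigma(\Delta(v))$ for all $v\in\mathrm{dom}(\Delta)$. The judgment is defined inductively by the rules: - $\Sigma;\Gamma;\emptyset\vdash_\kappa\mathbf 0$. - $\Sigma;\Gamma;\tilde u:\tilde t\vdash_\kappa X$, if $\Gamma(X)=\{\tilde u:\tilde t\}$ with $\tilde t$ pairwise distinct type variables in $\mathrm{dom}(\Sigma)$. - $\Sigma;\Gamma;\Delta,u:{?}[\alpha,\beta]S.T\vdash_\kappa u?(x).P$, if $\Sigma;\Gamma;\Delta,u:T,x:S\vdash_\kappa P$ and $\beta<\mathrm{ob}_\Sigma(\Delta)$. - $\Sigma;\Gamma;\Delta,u:{!}[\alpha,\beta]S.T,v:S\vdash_\kappa u!v.P$, if $\Sigma;\Gamma;\Delta,u:T\vdash_\kappa P$, $\beta<\mathrm{ob}_\Sigma(S)$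 and $\beta<\mathrm{ob}_\Sigma(\Delta)$. - $\Sigma;\Gamma;\Delta_1,\Delta_2\vdash_\kappa P|Q$, if $\Sigma;\Gamma;\Delta_1\vdash_\kappa P$ and $\Sigma;\Gamma;\Delta_2\vdash_\kappa Q$. - $\Sigma;\Gamma;\Delta,u:\mathsf{end}\vdash_\kappa P$, if $\Sigma;\Gamma;\Delta\vdash_\kappa P$. - $\Sigma;\Gamma;\tilde u:\mathsf{rec}^\iota\tilde t.\tilde T\vdash_\kappa\mathsf{rec}^\iota X.P$, if $\iota\le\kappa$ and $\Sigma,\tilde t:\mathrm{ob}_\Sigma(\tilde T);\ \Gamma,X:\{\tilde u:\tilde t\};\ \tilde u:\tilde T\vdash_\kappa P$, where $\tilde u$ is a possibly empty finite sequence of distinct names, and the bound variables $X$ and $\tilde t$ are renamed so as to be pairwise distinct and fresh (each $t_i$ occurs free in no $T_j$ with $j\ne i$). - $\Sigma;\Gamma;\Delta\vdash_\kappa(\nu a)P$, if $\Sigma;\Gamma;\Delta,a^+:T,a^-:S\vdash_\kappa P$ for some $T\bowtie S$ with free type variables in $\mathrm{dom}(\Sigma)$, where the bound channel $a$ is fresh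 for $\Gamma$ and $\Delta$. **Theorem.** Let $P$ be a user process such that $\emptyset;\emptyset;\emptyset\vdash_0\lfloor P\rfloor_0$ is derivable. Then $P$ has progress. -/

import Mathlib

/-!
A synchronous pi-calculus with binary sessions, session types decorated with priorities, the type
system, and the progress property.  Processes and session types are taken up to renaming of bound
names, so they are represented with de Bruijn indices: variables, channels, process variables and
type variables are four separate index spaces, and index `0` is the innermost binder. -/

namespace Session

/-! ### Processes -/

inductive Polarity
  | pos
  | neg
  deriving DecidableEq

/-- The involution exchanging the two polarities. -/
def Polarity.co : Polarity → Polarity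
  | .pos => .neg
  | .neg => .pos

/-- Names: variables, and endpoints `a^p` (a channel `a` decorated with a polarity `p`). -/
inductive Name
  | var (x : ℕ)
  | ep (a : ℕ) (p : Polarity)
  deriving DecidableEq

/-- Apply `v` to variables and `c` to channels. -/
def Name.subst (v : ℕ → Name) (c : ℕ → ℕ) : Name → Name
  | .var x => v x
  | .ep a p => .ep (c a) p

/-- Processes.  `inp u P` is `u?(x).P` and binds a variable, `out u v P` is `u!v.P`, `new P` is
`(ν a) P` and binds a channel (both of its endpoints), and `recur ι P` is `rec^ι X. P` and binds a
process variable.  The index `ι` is a natural number or `∞`. -/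
inductive Proc
  | idle
  | pvar (X : ℕ)
  | inp (u : Name) (P : Proc)
  | out (u v : Name) (P : Proc)
  | par (P Q : Proc)
  | new (P : Proc)
  | recur (ι : ℕ∞) (P : Proc)

/-- A renaming of indices, extended under one binder. -/
def liftRen (f : ℕ → ℕ) : ℕ → ℕ
  | 0 => 0
  | k + 1 => f k + 1

/-- A substitution of names for variables, extended under a binder for a variable. -/
def liftVar (v : ℕ → Name) : ℕ → Name
  | 0 => .var 0
  | k + 1 => (v k).subst (fun x => .var (x + 1)) id

/-- A substitution of names for variables, moved under a binder for a channel. -/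
def liftChan (v : ℕ → Name) : ℕ → Name :=
  fun k => (v k).subst .var Nat.succ

/-- Capture-avoiding simultaneous action on the free indices of a process: `v` substitutes names for
variables, `c` renames channels and `h` renames process variables. -/
def Proc.ren (v : ℕ → Name) (c h : ℕ → ℕ) : Proc → Proc
  | .idle => .idle
  | .pvar X => .pvar (h X)
  | .inp u P => .inp (u.subst v c) (P.ren (liftVar v) c h)
  | .out u w P => .out (u.subst v c) (w.subst v c) (P.ren v c h)
  | .par P Q => .par (P.ren v c h) (Q.ren v c h)
  | .new P => .new (P.ren (liftChan v) (liftRen c) h)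
  | .recur ι P => .recur ι (P.ren v c (liftRen h))

/-- Move a process under a binder for a variable. -/
def Proc.shiftVar (P : Proc) : Proc := P.ren (fun x => .var (x + 1)) id id

/-- Move a process under a binder for a channel. -/
def Proc.shiftChan (P : Proc) : Proc := P.ren .var Nat.succ id

/-- Move a process under a binder for a process variable. -/
def Proc.shiftPVar (P : Proc) : Proc := P.ren .var id Nat.succ

/-- `P{w/x}`, where `x` is the variable bound around `P`. -/
def Proc.instName (P : Proc) (w : Name) : Proc :=
  P.ren (fun
    | 0 => w
    | k + 1 => .var k) id id

/-- Exchange the two innermost channels. -/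
def Proc.swapChan (P : Proc) : Proc := P.ren .var (Equiv.swap 0 1) id

/-- A substitution of processes for process variables, extended under a recursion. -/
def liftProc (τ : ℕ → Proc) : ℕ → Proc
  | 0 => .pvar 0
  | k + 1 => (τ k).shiftPVar

/-- Capture-avoiding substitution of processes for process variables. -/
def Proc.subst (τ : ℕ → Proc) : Proc → Proc
  | .idle => .idle
  | .pvar X => τ X
  | .inp u P => .inp u (P.subst fun X => (τ X).shiftVar)
  | .out u w P => .out u w (P.subst τ)
  | .par P Q => .par (P.subst τ) (Q.subst τ)
  | .new P => .new (P.subst fun X => (τ X).shiftChan)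
  | .recur ι P => .recur ι (P.subst (liftProc τ))

/-- `P{Q/X}`, where `X` is the process variable bound around `P`. -/
def Proc.instProc (P Q : Proc) : Proc :=
  P.subst fun
    | 0 => Q
    | k + 1 => .pvar k

/-- `(ν a₁) ⋯ (ν aₙ) P`. -/
def Proc.news : ℕ → Proc → Proc
  | 0, P => P
  | n + 1, P => .new (P.news n)

/-- User processes: every recursion has index `∞`. -/
def Proc.IsUser : Proc → Prop
  | .idle => True
  | .pvar _ => True
  | .inp _ P => P.IsUser
  | .out _ _ P => P.IsUser
  | .par P Q => P.IsUser ∧ Q.IsUser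
  | .new P => P.IsUser
  | .recur ι P => ι = ⊤ ∧ P.IsUser

/-- The `κ`-approximant of a process: every `rec^∞` is turned into `rec^κ`. -/
def Proc.approx (κ : ℕ∞) : Proc → Proc
  | .idle => .idle
  | .pvar X => .pvar X
  | .inp u P => .inp u (P.approx κ)
  | .out u w P => .out u w (P.approx κ)
  | .par P Q => .par (P.approx κ) (Q.approx κ)
  | .new P => .new (P.approx κ)
  | .recur ι P => .recur (if ι = ⊤ then κ else ι) (P.approx κ)

/-! ### Structural congruence, reduction and progress -/

/-- Structural congruence: the least congruence containing the monoid laws of parallel composition,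
exchange of restrictions and scope extrusion. -/
inductive StructCong : Proc → Proc → Prop
  | refl (P) : StructCong P P
  | symm {P Q} : StructCong P Q → StructCong Q P
  | trans {P Q R} : StructCong P Q → StructCong Q R → StructCong P R
  | inp {P Q} (u) : StructCong P Q → StructCong (.inp u P) (.inp u Q)
  | out {P Q} (u v) : StructCong P Q → StructCong (.out u v P) (.out u v Q)
  | par {P P' Q Q'} : StructCong P P' → StructCong Q Q' → StructCong (.par P Q) (.par P' Q')
  | new {P Q} : StructCong P Q → StructCong (.new P) (.new Q)
  | recur {P Q} (ι) : StructCong P Q → StructCong (.recur ι P) (.recur ι Q)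
  | par_idle (P) : StructCong (.par .idle P) P
  | par_comm (P Q) : StructCong (.par P Q) (.par Q P)
  | par_assoc (P Q R) : StructCong (.par P (.par Q R)) (.par (.par P Q) R)
  | new_swap (P) : StructCong (.new (.new P)) (.new (.new P.swapChan))
  | new_par (P Q) : StructCong (.par (.new P) Q) (.new (.par P Q.shiftChan))

/-- Reduction. -/
inductive Red : Proc → Proc → Prop
  | comm (a p c q P Q) :
      Red (.par (.out (.ep a p) (.ep c q) P) (.inp (.ep a p.co) Q)) (.par P (Q.instName (.ep c q)))
  | recur (ι P) : Red (.recur (ι + 1) P) (P.instProc (.recur ι P))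
  | new {P Q} : Red P Q → Red (.new P) (.new Q)
  | par {P P'} (Q) : Red P P' → Red (.par P Q) (.par P' Q)
  | struct {P P' Q Q'} : StructCong P P' → Red P' Q' → StructCong Q' Q → Red P Q

/-- `P →* Q`: finitely many reductions, where processes are read up to structural congruence. -/
def Reaches (P Q : Proc) : Prop :=
  ∃ P', Relation.ReflTransGen Red P P' ∧ StructCong P' Q

/-- Progress.  In the reduct of `Q`, the channel `a` is free and lies below the `m` restrictions, so
that its index is `a + m`. -/
def Proc.HasProgress (P : Proc) : Prop :=
  (∀ n a p c q P' Q,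
    Reaches P (.news n (.par (.out (.ep a p) (.ep c q) P') Q)) →
      ∃ m Q' R, Reaches Q (.news m (.par (.inp (.ep (a + m) p.co) Q') R))) ∧
  (∀ n a p P' Q,
    Reaches P (.news n (.par (.inp (.ep a p) P') Q)) →
      ∃ m c q Q' R, Reaches Q (.news m (.par (.out (.ep (a + m) p.co) (.ep c q) Q') R)))

/-! ### Session types -/

/-- Raw session types.  `inp α β S T` is `?[α,β]S.T`, `out α β S T` is `![α,β]S.T` and `mu ι T` is
`rec^ι t. T`, which binds a type variable.  The priority `α` is the obligation and `β` is the
capability of the action. -/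
inductive Ty
  | fin
  | var (t : ℕ)
  | inp (α β : ℕ) (S T : Ty)
  | out (α β : ℕ) (S T : Ty)
  | mu (ι : ℕ∞) (T : Ty)

def Ty.rename (f : ℕ → ℕ) : Ty → Ty
  | .fin => .fin
  | .var t => .var (f t)
  | .inp α β S T => .inp α β (S.rename f) (T.rename f)
  | .out α β S T => .out α β (S.rename f) (T.rename f)
  | .mu ι T => .mu ι (T.rename (liftRen f))

/-- A substitution of types for type variables, extended under a recursion. -/
def liftTy (σ : ℕ → Ty) : ℕ → Ty
  | 0 => .var 0
  | k + 1 => (σ k).rename Nat.succ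

/-- Capture-avoiding substitution of types for type variables. -/
def Ty.subst (σ : ℕ → Ty) : Ty → Ty
  | .fin => .fin
  | .var t => σ t
  | .inp α β S T => .inp α β (S.subst σ) (T.subst σ)
  | .out α β S T => .out α β (S.subst σ) (T.subst σ)
  | .mu ι T => .mu ι (T.subst (liftTy σ))

/-- `T{S/t}`, where `t` is the type variable bound around `T`. -/
def Ty.inst (T S : Ty) : Ty :=
  T.subst fun
    | 0 => S
    | k + 1 => .var k

/-- `T` is a type variable under a (possibly empty) sequence of recursions, and that variable has
index `k` outside of the sequence. -/
def Ty.Unguarded : ℕ → Ty → Prop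
  | k, .var t => t = k
  | k, .mu _ T => T.Unguarded (k + 1)
  | _, _ => False

/-- The session types whose free type variables are among the first `k`: they are contractive (no
subterm `rec t₁. ⋯ rec tₙ. t₁`) and stratified (message types are closed). -/
def Ty.WF : ℕ → Ty → Prop
  | _, .fin => True
  | k, .var t => t < k
  | k, .inp _ _ S T => S.WF 0 ∧ T.WF k
  | k, .out _ _ S T => S.WF 0 ∧ T.WF k
  | k, .mu _ T => ¬ T.Unguarded 0 ∧ T.WF (k + 1)

/-- Duality: the least relation closed under these rules. -/
inductive Dual : Ty → Ty → Prop
  | fin : Dual .fin .fin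
  | var (t) : Dual (.var t) (.var t)
  | inp_out {T T'} (α β S) : Dual T T' → Dual (.inp α β S T) (.out β α S T')
  | out_inp {T T'} (α β S) : Dual T T' → Dual (.out α β S T) (.inp β α S T')
  | mu {T S} (ι) : Dual T S → Dual (.mu ι T) (.mu ι S)
  | unfold_right {T S} (ι) : Dual T (.mu (ι + 1) S) → Dual T (S.inst (.mu ι S))
  | unfold_left {T S} (ι) : Dual (.mu (ι + 1) S) T → Dual (S.inst (.mu ι S)) T

/-- The obligation of a type in the type variable environment `Θ`.  It is meaningful when the free
type variables of the type are in the domain of `Θ`; the value at any other variable is `0`, which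
satisfies no constraint `β < 0`.  The entry pushed by a recursion is never read, because session
types are contractive. -/
def Ty.obl : List ℕ∞ → Ty → ℕ∞
  | _, .fin => ⊤
  | Θ, .var t => Θ.getD t 0
  | _, .inp α _ _ _ => α
  | _, .out α _ _ _ => α
  | Θ, .mu _ T => T.obl (0 :: Θ)

/-! ### The type system -/

/-- Name environments: partial maps from names to types. -/
abbrev Env := Name → Option Ty

/-- The empty environment. -/
def Env.empty : Env := fun _ => none

/-- The environment `Δ, u : T`, for `u` not in the domain of `Δ`. -/
abbrev Env.add (Δ : Env) (u : Name) (T : Ty) : Env := Function.update Δ u (some T)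

/-- The environment with domain `us` that maps each `u` in `us` to `T u`. -/
def Env.ofList (us : List Name) (T : Name → Ty) : Env :=
  fun u => if u ∈ us then some (T u) else none

/-- `Δ` is the composition `Δ₁, Δ₂` of two environments with disjoint domains. -/
def Env.IsComp (Δ₁ Δ₂ Δ : Env) : Prop :=
  ∀ u, (Δ₁ u = none ∧ Δ u = Δ₂ u) ∨ (Δ₂ u = none ∧ Δ u = Δ₁ u)

/-- The same environment, seen under a binder for a variable. -/
def Env.shiftVar (Δ : Env) : Env
  | .var 0 => none
  | .var (x + 1) => Δ (.var x)
  | .ep a p => Δ (.ep a p)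

/-- The same environment, seen under a binder for a channel. -/
def Env.shiftChan (Δ : Env) : Env
  | .var x => Δ (.var x)
  | .ep 0 _ => none
  | .ep (a + 1) p => Δ (.ep a p)

/-- The same environment, seen under `n` new type variables. -/
def Env.shiftTy (n : ℕ) (Δ : Env) : Env :=
  fun u => (Δ u).map (Ty.rename (· + n))

/-- For the body `T` of a recursive type, seen under `n` new type variables: the variable bound by
the recursion becomes the `i`-th new one, the other variables are unchanged. -/
def Ty.openAt (n i : ℕ) (T : Ty) : Ty :=
  T.rename fun
    | 0 => i
    | k + 1 => k + n

/-- The judgment `Θ; Γ; Δ ⊢_κ P`, where `Θ` assigns obligations to type variables, `Γ` assigns name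
environments to process variables, and `Δ` assigns types to names. -/
inductive Typing (κ : ℕ∞) : List ℕ∞ → List Env → Env → Proc → Prop
  | idle (Θ Γ) : Typing κ Θ Γ Env.empty .idle
  | var (Θ Γ X) (Δ : Env) :
      Γ[X]? = some Δ →
      (∀ u T, Δ u = some T → ∃ t < Θ.length, T = .var t) →
      (∀ u v T, Δ u = some T → Δ v = some T → u = v) →
      Typing κ Θ Γ Δ (.pvar X)
  | inp {Θ Γ} {Δ : Env} {P} (u : Name) (α β : ℕ) (S T : Ty) :
      Δ u = none →
      Typing κ Θ (Γ.map Env.shiftVar) ((Δ.add u T).shiftVar.add (.var 0) S) P →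
      (∀ v V, Δ v = some V → (β : ℕ∞) < V.obl Θ) →
      Typing κ Θ Γ (Δ.add u (.inp α β S T)) (.inp u P)
  | out {Θ Γ} {Δ : Env} {P} (u v : Name) (α β : ℕ) (S T : Ty) :
      Δ u = none → Δ v = none → u ≠ v →
      Typing κ Θ Γ (Δ.add u T) P →
      (β : ℕ∞) < S.obl Θ →
      (∀ w V, Δ w = some V → (β : ℕ∞) < V.obl Θ) →
      Typing κ Θ Γ ((Δ.add u (.out α β S T)).add v S) (.out u v P)
  | par {Θ Γ} {Δ₁ Δ₂ Δ : Env} {P Q} :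
      Env.IsComp Δ₁ Δ₂ Δ →
      Typing κ Θ Γ Δ₁ P →
      Typing κ Θ Γ Δ₂ Q →
      Typing κ Θ Γ Δ (.par P Q)
  | fin {Θ Γ} {Δ : Env} {P} (u : Name) :
      Δ u = none →
      Typing κ Θ Γ Δ P →
      Typing κ Θ Γ (Δ.add u .fin) P
  | recur {Θ Γ P} (ι : ℕ∞) (us : List Name) (T : Name → Ty) :
      us.Nodup →
      ι ≤ κ →
      Typing κ
        (us.map (fun u => (Ty.mu ι (T u)).obl Θ) ++ Θ)
        (Env.ofList us (fun u => .var (us.idxOf u)) :: Γ.map (Env.shiftTy us.length))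
        (Env.ofList us (fun u => (T u).openAt us.length (us.idxOf u)))
        P →
      Typing κ Θ Γ (Env.ofList us (fun u => .mu ι (T u))) (.recur ι P)
  | new {Θ Γ} {Δ : Env} {P} (T S : Ty) :
      T.WF Θ.length → S.WF Θ.length →
      Dual T S →
      Typing κ Θ (Γ.map Env.shiftChan) ((Δ.shiftChan.add (.ep 0 .pos) T).add (.ep 0 .neg) S) P →
      Typing κ Θ Γ Δ (.new P)

end Session

namespace Session

/-! ### Renaming and substitution of processes -/

/-! The given derivation speaks of `rec^0` only, whereas the process may unfold its recursions for
ever. The interpretation of types bridges this gap. For each `n` a type denotes a recursion-free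
`Tree`, where a finite index `ι` stands for `ι + n` unfoldings cut off by `end`. Unfolding becomes
an equality of trees (`Ty.interp_mu_succ`), so dual closed types denote dual trees (`Dual.interp`).
The body of a `rec^0` is typed at approximation `j + 1` of its environment once its process variable
is typed at approximation `j`; at approximation `0` no name is usable and nothing is left to check.
Hence the one derivation yields, for every `n`, a finite derivation in `WT` of the full process with
its recursions unfolded (`Typing.semantic`).

In `WT` the budget `n` tells how many unfoldings precede any unchecked part. A reduction costs at
most one unit (`WT.red`), so a reachable process is still typed at every budget (`WT.reaches`).
Budget `1` guarantees that an exposed prefix really owns its subject.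

After that, budget `0` is enough, and the size of the derivation bounds the work left. Suppose a
prefix waits and its peer, of obligation `b`, is somewhere in the rest. The thread that holds the
peer is a recursion, which is unfolded; or a prefix on the peer, which is the goal; or a prefix on
another endpoint, whose capability `β` is below `b`. In the last case the endpoint it waits for has
obligation `β` and lies outside of this thread, so strong induction on obligations either exposes
it, and the two prefixes communicate, or finds a reduction (`WT.descent`). Strict decrease of
priorities is what excludes circular waiting. Each reduction chosen this way shrinks the derivation,
so induction on the size exposes the peer (`WT.reaches_prefix`), and duality of the types gives it
the right direction. -/

theorem Name.subst_subst (u : Name) (v v' : ℕ → Name) (c c' : ℕ → ℕ) :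
    (u.subst v c).subst v' c' = u.subst (fun x => (v x).subst v' c') (c' ∘ c) := by
  cases u <;> rfl

@[simp] theorem Name.subst_var_id (u : Name) : u.subst .var id = u := by cases u <;> rfl

theorem liftRen_comp (f g : ℕ → ℕ) : liftRen (g ∘ f) = liftRen g ∘ liftRen f := by
  funext k; cases k <;> rfl

@[simp] theorem liftRen_id : liftRen id = id := by funext k; cases k <;> rfl

@[simp] theorem liftVar_var : liftVar .var = .var := by funext k; cases k <;> rfl

@[simp] theorem liftChan_var : liftChan .var = .var := by funext k; rfl

theorem liftVar_subst (v v' : ℕ → Name) (c' : ℕ → ℕ) :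
    liftVar (fun x => (v x).subst v' c') = fun x => (liftVar v x).subst (liftVar v') c' := by
  funext k
  cases k with
  | zero => rfl
  | succ k => simp only [liftVar]; cases v k <;> rfl

theorem liftChan_subst (v v' : ℕ → Name) (c' : ℕ → ℕ) :
    liftChan (fun x => (v x).subst v' c') =
      fun x => (liftChan v x).subst (liftChan v') (liftRen c') := by
  funext k
  simp only [liftChan]; cases v k <;> rfl

theorem Proc.ren_ren (P : Proc) (v v' : ℕ → Name) (c c' h h' : ℕ → ℕ) :
    (P.ren v c h).ren v' c' h' =
      P.ren (fun x => (v x).subst v' c') (c' ∘ c) (h' ∘ h) := by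
  induction P generalizing v v' c c' h h' with
  | idle => rfl
  | pvar X => rfl
  | inp u P ih => simp only [Proc.ren, ih, liftVar_subst, Name.subst_subst]
  | out u w P ih => simp only [Proc.ren, ih, Name.subst_subst]
  | par P Q ihP ihQ => simp only [Proc.ren, ihP, ihQ]
  | new P ih => simp only [Proc.ren, ih, liftChan_subst, liftRen_comp]
  | recur ι P ih => simp only [Proc.ren, ih, liftRen_comp]

@[simp] theorem Proc.ren_id (P : Proc) : P.ren .var id id = P := by
  induction P <;> simp_all [Proc.ren]

theorem Proc.shiftVar_ren (P : Proc) (v : ℕ → Name) (c h : ℕ → ℕ) :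
    P.shiftVar.ren (liftVar v) c h = (P.ren v c h).shiftVar := by
  simp only [Proc.shiftVar, Proc.ren_ren]; rfl

theorem Proc.shiftChan_ren (P : Proc) (v : ℕ → Name) (c h : ℕ → ℕ) :
    P.shiftChan.ren (liftChan v) (liftRen c) h = (P.ren v c h).shiftChan := by
  simp only [Proc.shiftChan, Proc.ren_ren]; rfl

theorem Proc.shiftPVar_ren (P : Proc) (v : ℕ → Name) (c h : ℕ → ℕ) :
    P.shiftPVar.ren v c (liftRen h) = (P.ren v c h).shiftPVar := by
  simp only [Proc.shiftPVar, Proc.ren_ren]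
  congr 1; funext x; exact ((v x).subst_var_id).symm

/-- The renaming `h'` of the process variables of `P` may differ from `h`, because a substitution
can change their scope: in `Proc.instProc_ren` it is `liftRen h`. -/
theorem Proc.subst_ren (P : Proc) (τ τ' : ℕ → Proc) (v : ℕ → Name) (c h h' : ℕ → ℕ)
    (H : ∀ X, (τ X).ren v c h = τ' (h' X)) :
    (P.subst τ).ren v c h = (P.ren v c h').subst τ' := by
  induction P generalizing τ τ' v c h h' with
  | idle => rfl
  | pvar X => exact H X
  | inp u P ih =>
    simp only [Proc.ren, Proc.subst]
    rw [ih _ (fun X => (τ' X).shiftVar) _ _ _ h' fun X => by rw [Proc.shiftVar_ren, H]]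
  | out u w P ih => simp only [Proc.ren, Proc.subst]; rw [ih _ _ _ _ _ _ H]
  | par P Q ihP ihQ =>
    simp only [Proc.ren, Proc.subst]; rw [ihP _ _ _ _ _ _ H, ihQ _ _ _ _ _ _ H]
  | new P ih =>
    simp only [Proc.ren, Proc.subst]
    rw [ih _ (fun X => (τ' X).shiftChan) _ _ _ h' fun X => by rw [Proc.shiftChan_ren, H]]
  | recur ι P ih =>
    simp only [Proc.ren, Proc.subst]
    rw [ih _ (liftProc τ') _ _ _ (liftRen h')]
    rintro (_ | X)
    · rfl
    · simp only [liftProc, liftRen, Proc.shiftPVar_ren, H]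

theorem Proc.instProc_ren (P R : Proc) (v : ℕ → Name) (c h : ℕ → ℕ) :
    (P.instProc R).ren v c h = (P.ren v c (liftRen h)).instProc (R.ren v c h) := by
  refine Proc.subst_ren _ _ _ _ _ _ _ ?_
  rintro (_ | X) <;> rfl

theorem Proc.subst_subst (P : Proc) (τ τ' : ℕ → Proc) :
    (P.subst τ).subst τ' = P.subst fun X => (τ X).subst τ' := by
  induction P generalizing τ τ' with
  | idle => rfl
  | pvar X => rfl
  | inp u P ih =>
    simp only [Proc.subst, ih]
    congr; funext X
    exact (Proc.subst_ren _ _ _ _ _ _ _ fun X => rfl).symm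
  | out u w P ih => simp only [Proc.subst, ih]
  | par P Q ihP ihQ => simp only [Proc.subst, ihP, ihQ]
  | new P ih =>
    simp only [Proc.subst, ih]
    congr; funext X
    exact (Proc.subst_ren _ _ _ _ _ _ _ fun X => rfl).symm
  | recur ι P ih =>
    simp only [Proc.subst, ih]
    congr; funext X
    cases X with
    | zero => rfl
    | succ X => exact (Proc.subst_ren _ _ _ _ _ _ _ fun X => rfl).symm

@[simp] theorem liftProc_pvar : liftProc .pvar = .pvar := by funext k; cases k <;> rfl

@[simp] theorem Proc.subst_pvar (P : Proc) : P.subst .pvar = P := by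
  induction P with
  | inp u P ih => simpa [Proc.subst, Proc.shiftVar, Proc.ren] using ih
  | new P ih => simpa [Proc.subst, Proc.shiftChan, Proc.ren] using ih
  | _ => simp_all [Proc.subst]

theorem Proc.shiftPVar_instProc (P R : Proc) : P.shiftPVar.instProc R = P := by
  have := Proc.subst_ren P .pvar .var id id Nat.succ (τ' := fun | 0 => R | k + 1 => .pvar k)
    fun X => rfl
  rw [Proc.subst_pvar, Proc.ren_id] at this
  exact this.symm

/-- A substitution of processes for process variables, extended by `R` for the innermost one. -/
def consProc (R : Proc) (τ : ℕ → Proc) : ℕ → Proc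
  | 0 => R
  | X + 1 => τ X

/-- Reconciles two views of an unfolding: an induction over typing derivations substitutes for all
process variables at once, while `WT.recur` unfolds an already substituted body. -/
theorem Proc.subst_liftProc_instProc (P R : Proc) (τ : ℕ → Proc) :
    (P.subst (liftProc τ)).instProc R = P.subst (consProc R τ) := by
  rw [Proc.instProc, Proc.subst_subst]
  congr; funext X
  cases X with
  | zero => rfl
  | succ X => exact Proc.shiftPVar_instProc _ _

theorem Proc.swapChan_ren (P : Proc) (v : ℕ → Name) (c h : ℕ → ℕ) :
    P.swapChan.ren (liftChan (liftChan v)) (liftRen (liftRen c)) h =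
      (P.ren (liftChan (liftChan v)) (liftRen (liftRen c)) h).swapChan := by
  simp only [Proc.swapChan, Proc.ren_ren]
  congr 1
  · funext x
    simp only [liftChan, Name.subst]
    cases v x with
    | var y => rfl
    | ep a p => simp [Equiv.swap_apply_of_ne_of_ne]
  · funext a
    match a with
    | 0 => rfl
    | 1 => rfl
    | a + 2 => simp [liftRen, Equiv.swap_apply_of_ne_of_ne]

@[simp] theorem Proc.swapChan_swapChan (P : Proc) : P.swapChan.swapChan = P := by
  simp only [Proc.swapChan, Proc.ren_ren]
  conv_rhs => rw [← P.ren_id]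
  congr 1
  funext a; simp

/-- Move a process under `m` binders for channels. -/
def Proc.shiftChans (m : ℕ) (P : Proc) : Proc := P.ren .var (· + m) id

theorem Proc.shiftChans_zero (P : Proc) : P.shiftChans 0 = P := P.ren_id

theorem Proc.shiftChans_shiftChan (m : ℕ) (P : Proc) :
    P.shiftChan.shiftChans m = P.shiftChans (m + 1) := by
  simp only [Proc.shiftChan, Proc.shiftChans, Proc.ren_ren]
  congr 1; funext a; simp; omega

/-! ### Structural congruence -/

theorem StructCong.ren {P Q : Proc} (H : StructCong P Q) (v : ℕ → Name) (c h : ℕ → ℕ) :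
    StructCong (P.ren v c h) (Q.ren v c h) := by
  induction H generalizing v c h with
  | refl P => exact .refl _
  | symm _ ih => exact (ih v c h).symm
  | trans _ _ ih₁ ih₂ => exact (ih₁ v c h).trans (ih₂ v c h)
  | inp u _ ih => exact .inp _ (ih _ _ _)
  | out u w _ ih => exact .out _ _ (ih _ _ _)
  | par _ _ ih₁ ih₂ => exact .par (ih₁ _ _ _) (ih₂ _ _ _)
  | new _ ih => exact .new (ih _ _ _)
  | recur ι _ ih => exact .recur _ (ih _ _ _)
  | par_idle P => exact .par_idle _
  | par_comm P Q => exact .par_comm _ _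
  | par_assoc P Q R => exact .par_assoc _ _ _
  | new_swap P =>
    simp only [Proc.ren]
    rw [Proc.swapChan_ren]
    exact .new_swap _
  | new_par P Q =>
    simp only [Proc.ren]
    rw [Proc.shiftChan_ren]
    exact .new_par _ _

theorem StructCong.subst_of_forall (P : Proc) {τ τ' : ℕ → Proc}
    (H : ∀ X, StructCong (τ X) (τ' X)) : StructCong (P.subst τ) (P.subst τ') := by
  induction P generalizing τ τ' with
  | idle => exact .refl _
  | pvar X => exact H X
  | inp u P ih => exact .inp _ (ih fun X => (H X).ren _ _ _)
  | out u w P ih => exact .out _ _ (ih H)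
  | par P Q ihP ihQ => exact .par (ihP H) (ihQ H)
  | new P ih => exact .new (ih fun X => (H X).ren _ _ _)
  | recur ι P ih =>
    refine .recur _ (ih ?_)
    rintro (_ | X)
    · exact .refl _
    · exact (H X).ren _ _ _

theorem StructCong.subst {P Q : Proc} (H : StructCong P Q) (τ : ℕ → Proc) :
    StructCong (P.subst τ) (Q.subst τ) := by
  induction H generalizing τ with
  | refl P => exact .refl _
  | symm _ ih => exact (ih τ).symm
  | trans _ _ ih₁ ih₂ => exact (ih₁ τ).trans (ih₂ τ)
  | inp u _ ih => exact .inp _ (ih _)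
  | out u w _ ih => exact .out _ _ (ih _)
  | par _ _ ih₁ ih₂ => exact .par (ih₁ _) (ih₂ _)
  | new _ ih => exact .new (ih _)
  | recur ι _ ih => exact .recur _ (ih _)
  | par_idle P => exact .par_idle _
  | par_comm P Q => exact .par_comm _ _
  | par_assoc P Q R => exact .par_assoc _ _ _
  | new_swap P =>
    simp only [Proc.subst]
    have := Proc.subst_ren P (fun X => (τ X).shiftChan.shiftChan)
      (fun X => (τ X).shiftChan.shiftChan) .var (Equiv.swap 0 1) id id fun X => by
        simp only [Proc.shiftChan, Proc.ren_ren]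
        congr 1
    rw [Proc.swapChan, ← this]
    exact .new_swap _
  | new_par P Q =>
    simp only [Proc.subst]
    have := Proc.subst_ren Q τ (fun X => (τ X).shiftChan) .var Nat.succ id id fun X => rfl
    rw [Proc.shiftChan, ← this]
    exact .new_par _ _

theorem StructCong.instProc {P Q R S : Proc} (H : StructCong P Q) (H' : StructCong R S) :
    StructCong (P.instProc R) (Q.instProc S) := by
  refine (H.subst _).trans (StructCong.subst_of_forall _ ?_)
  rintro (_ | X)
  · exact H'
  · exact .refl _

theorem StructCong.news {P Q : Proc} (H : StructCong P Q) (m : ℕ) :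
    StructCong (P.news m) (Q.news m) := by
  induction m with
  | zero => exact H
  | succ m ih => exact .new ih

theorem StructCong.news_par (m : ℕ) (P Q : Proc) :
    StructCong (.par (P.news m) Q) ((Proc.par P (Q.shiftChans m)).news m) := by
  induction m generalizing Q with
  | zero => rw [Proc.shiftChans_zero]; exact .refl _
  | succ m ih =>
    refine (StructCong.new_par _ _).trans (.new ?_)
    rw [← Proc.shiftChans_shiftChan]
    exact ih _

theorem Red.news {P Q : Proc} (H : Red P Q) (m : ℕ) : Red (P.news m) (Q.news m) := by
  induction m with
  | zero => exact H
  | succ m ih => exact .new ih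

/-! ### Unfolded session types -/

/-- The topmost action of a session type. -/
inductive Label
  | fin
  | inp (α β : ℕ)
  | out (α β : ℕ)

/-- Session types without recursion, possibly infinite: a label for each path, where `false` leads to
the message type and `true` to the continuation. -/
def Tree : Type := List Bool → Label

namespace Tree

def fin : Tree := fun _ => .fin

def node (l : Label) (S T : Tree) : Tree
  | [] => l
  | false :: p => S p
  | true :: p => T p

/-- The type `?[α,β]S.T`. -/
def inp (α β : ℕ) (S T : Tree) : Tree := node (.inp α β) S T

/-- The type `![α,β]S.T`. -/
def out (α β : ℕ) (S T : Tree) : Tree := node (.out α β) S T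

theorem node_inj {l l' : Label} {S T S' T' : Tree} (h : node l S T = node l' S' T') :
    l = l' ∧ S = S' ∧ T = T' :=
  ⟨congrFun h [], funext fun p => congrFun h (false :: p), funext fun p => congrFun h (true :: p)⟩

theorem inp_inj {α β α' β' : ℕ} {S T S' T' : Tree} (h : inp α β S T = inp α' β' S' T') :
    α = α' ∧ β = β' ∧ S = S' ∧ T = T' := by
  obtain ⟨h, h', h''⟩ := node_inj h
  cases h
  exact ⟨rfl, rfl, h', h''⟩

theorem inp_ne_out {α β α' β' : ℕ} {S T S' T' : Tree} : inp α β S T ≠ out α' β' S' T' :=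
  fun h => nomatch (node_inj h).1

theorem inp_ne_fin {α β : ℕ} {S T : Tree} : inp α β S T ≠ fin := fun h => nomatch congrFun h []

theorem out_ne_fin {α β : ℕ} {S T : Tree} : out α β S T ≠ fin := fun h => nomatch congrFun h []

/-- The obligation of a type. -/
def obl (T : Tree) : ℕ∞ :=
  match T [] with
  | .fin => ⊤
  | .inp α _ => α
  | .out α _ => α

/-- The capability of a type. -/
def cap (T : Tree) : ℕ∞ :=
  match T [] with
  | .fin => ⊤
  | .inp _ β => β
  | .out _ β => β

@[simp] theorem obl_fin : fin.obl = ⊤ := rfl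
@[simp] theorem cap_fin : fin.cap = ⊤ := rfl

end Tree

/-- The label of the dual action. -/
def Label.dual : Label → Label
  | .fin => .fin
  | .inp α β => .out β α
  | .out α β => .inp β α

@[simp] theorem Label.dual_dual (l : Label) : l.dual.dual = l := by cases l <;> rfl

namespace Tree

/-- The dual type: message types are unchanged. -/
def dual (T : Tree) : Tree := fun p => if false ∈ p then T p else (T p).dual

@[simp] theorem dual_dual (T : Tree) : T.dual.dual = T := by
  funext p; simp only [dual]; split <;> simp

@[simp] theorem dual_fin : fin.dual = fin := by
  funext p; simp [dual, fin, Label.dual]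

theorem dual_node (l : Label) (S T : Tree) : (node l S T).dual = node l.dual S T.dual := by
  funext p
  match p with
  | [] => rfl
  | false :: p => simp [dual, node]
  | true :: p => simp [dual, node]

@[simp] theorem dual_inp (α β : ℕ) (S T : Tree) : (inp α β S T).dual = out β α S T.dual :=
  dual_node _ _ _

@[simp] theorem dual_out (α β : ℕ) (S T : Tree) : (out α β S T).dual = inp β α S T.dual :=
  dual_node _ _ _

@[simp] theorem dual_eq_fin {T : Tree} : T.dual = fin ↔ T = fin :=
  ⟨fun h => by rw [← T.dual_dual, h, dual_fin], fun h => by rw [h, dual_fin]⟩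

-- The capability of an endpoint is the obligation of its peer; every priority argument below rests
-- on this.
@[simp] theorem obl_dual (T : Tree) : T.dual.obl = T.cap := by
  simp only [obl, cap, dual, List.not_mem_nil, if_false]
  cases T [] <;> rfl

end Tree

/-! ### Semantic environments -/

/-- Environments that map every name to an unfolded type; `Tree.fin` at the names that may not be
used. -/
abbrev SEnv := Name → Tree

/-- `E` under a binder for a variable of type `S`. -/
def SEnv.pushVar (S : Tree) (E : SEnv) : SEnv
  | .var 0 => S
  | .var (x + 1) => E (.var x)
  | .ep a p => E (.ep a p)

/-- `E` under a binder for a channel with endpoints of type `T` and `T.dual`. -/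
def SEnv.pushChan (T : Tree) (E : SEnv) : SEnv
  | .var x => E (.var x)
  | .ep 0 .pos => T
  | .ep 0 .neg => T.dual
  | .ep (a + 1) p => E (.ep a p)

/-- `E` is the disjoint union of `E₁` and `E₂`. -/
def Split (E₁ E₂ E : SEnv) : Prop :=
  ∀ u, (E₁ u = .fin ∧ E u = E₂ u) ∨ (E₂ u = .fin ∧ E u = E₁ u)

theorem Split.symm {E₁ E₂ E : SEnv} (h : Split E₁ E₂ E) : Split E₂ E₁ E := fun u => (h u).symm

theorem Split.left_eq {E₁ E₂ E : SEnv} (h : Split E₁ E₂ E) {u : Name} (hu : E₁ u ≠ .fin) :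
    E u = E₁ u := ((h u).resolve_left fun h' => hu h'.1).2

theorem Split.right_eq_fin {E₁ E₂ E : SEnv} (h : Split E₁ E₂ E) {u : Name} (hu : E₁ u ≠ .fin) :
    E₂ u = .fin := ((h u).resolve_left fun h' => hu h'.1).1

theorem Split.eq_right {E₁ E₂ E : SEnv} (h : Split E₁ E₂ E) {u : Name} (hu : E₁ u = .fin) :
    E u = E₂ u := by
  rcases h u with ⟨_, h⟩ | ⟨h, h'⟩
  · exact h
  · rw [h', hu, h]

theorem Split.eq_left {E₁ E₂ E : SEnv} (h : Split E₁ E₂ E) {u : Name} (hu : E₂ u = .fin) :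
    E u = E₁ u := h.symm.eq_right hu

theorem Split.left_of_eq_fin {E₁ E₂ E : SEnv} (h : Split E₁ E₂ E) {u : Name} (hu : E u = .fin) :
    E₁ u = .fin := by
  by_contra h'; exact h' ((h.left_eq h').symm.trans hu)

theorem Split.eq_fin {E₁ E₂ E : SEnv} (h : Split E₁ E₂ E) (h₁ : ∀ u, E₁ u = .fin) : E = E₂ :=
  funext fun u => h.eq_right (h₁ u)

theorem Split.of_fin {E₁ : SEnv} (h₁ : ∀ u, E₁ u = .fin) (E : SEnv) : Split E₁ E E :=
  fun u => .inl ⟨h₁ u, rfl⟩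

theorem Split.assoc {E₁ E₂ E₃ E₂₃ E : SEnv} (h : Split E₁ E₂₃ E) (h' : Split E₂ E₃ E₂₃) :
    ∃ E₁₂, Split E₁ E₂ E₁₂ ∧ Split E₁₂ E₃ E := by
  classical
  refine ⟨fun u => if E₁ u = .fin then E₂ u else E₁ u, fun u => ?_, fun u => ?_⟩
  · dsimp only
    split_ifs with h₁
    · exact .inl ⟨h₁, rfl⟩
    · refine .inr ⟨?_, rfl⟩
      exact h'.left_of_eq_fin (h.right_eq_fin h₁)
  · dsimp only
    split_ifs with h₁
    · rw [h.eq_right h₁]; exact h' u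
    · refine .inr ⟨h'.symm.left_of_eq_fin (h.right_eq_fin h₁), h.left_eq h₁⟩

/-- Both endpoints of the new channel go to the left component, as scope extrusion requires. -/
theorem Split.pushChan {E₁ E₂ E : SEnv} (h : Split E₁ E₂ E) (T : Tree) :
    Split (E₁.pushChan T) (E₂.pushChan .fin) (E.pushChan T) := by
  intro u
  match u with
  | .var x => exact h (.var x)
  | .ep 0 .pos => exact .inr ⟨rfl, rfl⟩
  | .ep 0 .neg => exact .inr ⟨Tree.dual_fin, rfl⟩
  | .ep (a + 1) p => exact h (.ep a p)

/-- `E'` is the image of `E` under the map `θ` of names, which is injective on the names used. -/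
structure Push (θ : Name → Name) (E E' : SEnv) : Prop where
  -- Only usable names are constrained, so an unusable name may be sent to one in use. This happens
  -- when a name is received at type `end`.
  map : ∀ u, E u ≠ .fin → E' (θ u) = E u
  inj : ∀ u v, E u ≠ .fin → E v ≠ .fin → θ u = θ v → u = v
  surj : ∀ w, E' w ≠ .fin → ∃ u, θ u = w ∧ E u ≠ .fin

theorem Push.eq_fin {θ : Name → Name} {E E' : SEnv} (h : Push θ E E') (hE : ∀ u, E u = .fin)
    (w : Name) : E' w = .fin := by
  by_contra hw
  obtain ⟨u, _, hu⟩ := h.surj w hw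
  exact hu (hE u)

/-- Each component receives the images of its own usable names; injectivity keeps the two images
disjoint. -/
theorem Push.split {θ : Name → Name} {E₁ E₂ E E' : SEnv} (h : Push θ E E') (hs : Split E₁ E₂ E) :
    ∃ E₁' E₂', Split E₁' E₂' E' ∧ Push θ E₁ E₁' ∧ Push θ E₂ E₂' := by
  classical
  have key : ∀ {F G : SEnv}, Split F G E →
      Push θ F fun w => if ∃ u, θ u = w ∧ F u ≠ .fin then E' w else .fin := by
    intro F G hs
    have hne : ∀ {u}, F u ≠ .fin → E u ≠ .fin := fun hu => by rwa [hs.left_eq hu]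
    refine ⟨fun u hu => ?_, fun u v hu hv => h.inj u v (hne hu) (hne hv), fun w hw => ?_⟩
    · rw [if_pos ⟨u, rfl, hu⟩, h.map u (hne hu), hs.left_eq hu]
    · by_contra hn; exact hw (if_neg hn)
  refine ⟨_, _, fun w => ?_, key hs, key hs.symm⟩
  by_cases hw : E' w = .fin
  · left; simp [hw]
  · obtain ⟨u, rfl, hu⟩ := h.surj w hw
    have aux : ∀ {F G : SEnv}, Split F G E → F u ≠ .fin → ¬ ∃ u', θ u' = θ u ∧ G u' ≠ .fin := by
      rintro F G hs hF ⟨u', he, hG⟩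
      have := h.inj u' u (by rwa [hs.symm.left_eq hG]) hu he
      subst this
      exact hG (hs.right_eq_fin hF)
    by_cases h₁ : E₁ u = .fin
    · have h₂ : E₂ u ≠ .fin := by rwa [← hs.eq_right h₁]
      left
      rw [if_neg (aux hs.symm h₂), if_pos ⟨u, rfl, h₂⟩]; exact ⟨rfl, rfl⟩
    · right
      rw [if_neg (aux hs h₁), if_pos ⟨u, rfl, h₁⟩]; exact ⟨rfl, rfl⟩

theorem Push.update {θ : Name → Name} {E E' : SEnv} (h : Push θ E E') {u : Name} (hu : E u ≠ .fin)
    (T : Tree) : Push θ (Function.update E u T) (Function.update E' (θ u) T) := by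
  have hne : ∀ {v}, Function.update E u T v ≠ .fin → E v ≠ .fin := by
    intro v hv
    by_cases hvu : v = u
    · rwa [hvu]
    · rwa [Function.update_of_ne hvu] at hv
  refine ⟨fun v hv => ?_, fun v w hv hw => h.inj v w (hne hv) (hne hw), fun w hw => ?_⟩
  · by_cases hvu : v = u
    · subst hvu; simp
    · rw [Function.update_of_ne hvu, Function.update_of_ne, h.map v (hne hv)]
      exact fun e => hvu (h.inj v u (hne hv) hu e)
  · by_cases hwu : w = θ u
    · subst hwu
      exact ⟨u, rfl, by simpa using hw⟩
    · rw [Function.update_of_ne hwu] at hw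
      obtain ⟨v, rfl, hv⟩ := h.surj w hw
      refine ⟨v, rfl, ?_⟩
      rwa [Function.update_of_ne]
      rintro rfl; exact hwu rfl

theorem Push.pushVar {v : ℕ → Name} {c : ℕ → ℕ} {E E' : SEnv}
    (h : Push (Name.subst v c) E E') (S : Tree) :
    Push (Name.subst (liftVar v) c) (E.pushVar S) (E'.pushVar S) := by
  -- Names other than the new variable are shifted names.
  have hE : ∀ (F : SEnv) (u : Name), F.pushVar S (u.subst (fun x => .var (x + 1)) id) = F u := by
    intro F u; cases u <;> rfl
  have hθ : ∀ u : Name, (u.subst (fun x => .var (x + 1)) id).subst (liftVar v) c =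
      (u.subst v c).subst (fun x => .var (x + 1)) id := by
    intro u; cases u <;> rfl
  have hcases : ∀ u : Name, u = .var 0 ∨ ∃ w : Name, u = w.subst (fun x => .var (x + 1)) id := by
    intro u
    match u with
    | .var 0 => exact .inl rfl
    | .var (x + 1) => exact .inr ⟨.var x, rfl⟩
    | .ep a p => exact .inr ⟨.ep a p, rfl⟩
  have hinj : ∀ u w : Name, u.subst (fun x => .var (x + 1)) id =
      w.subst (fun x => .var (x + 1)) id → u = w := by
    intro u w h; cases u <;> cases w <;> simp_all [Name.subst]
  have h0 : ∀ u : Name, u.subst (fun x => .var (x + 1)) id ≠ .var 0 := by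
    intro u h; cases u <;> simp [Name.subst] at h
  refine ⟨fun u hu => ?_, fun u w hu hw e => ?_, fun w hw => ?_⟩
  · obtain rfl | ⟨u, rfl⟩ := hcases u
    · rfl
    · rw [hE] at hu
      rw [hθ, hE, hE, h.map u hu]
  · obtain rfl | ⟨u, rfl⟩ := hcases u <;> obtain rfl | ⟨w, rfl⟩ := hcases w
    · rfl
    · rw [hθ] at e; exact absurd e.symm (h0 _)
    · rw [hθ] at e; exact absurd e (h0 _)
    · rw [hθ, hθ] at e
      rw [hE] at hu hw
      rw [h.inj u w hu hw (hinj _ _ e)]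
  · obtain rfl | ⟨w, rfl⟩ := hcases w
    · exact ⟨.var 0, rfl, hw⟩
    · rw [hE] at hw
      obtain ⟨u, rfl, hu⟩ := h.surj w hw
      exact ⟨_, hθ u, by rwa [hE]⟩

theorem Push.pushChan {v : ℕ → Name} {c : ℕ → ℕ} {E E' : SEnv}
    (h : Push (Name.subst v c) E E') (T : Tree) :
    Push (Name.subst (liftChan v) (liftRen c)) (E.pushChan T) (E'.pushChan T) := by
  have hE : ∀ (F : SEnv) (u : Name), F.pushChan T (u.subst .var Nat.succ) = F u := by
    intro F u; cases u <;> rfl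
  have hθ : ∀ u : Name, (u.subst .var Nat.succ).subst (liftChan v) (liftRen c) =
      (u.subst v c).subst .var Nat.succ := by
    intro u; cases u <;> rfl
  have hcases : ∀ u : Name, (∃ p, u = .ep 0 p) ∨ ∃ w : Name, u = w.subst .var Nat.succ := by
    intro u
    match u with
    | .ep 0 p => exact .inl ⟨p, rfl⟩
    | .ep (a + 1) p => exact .inr ⟨.ep a p, rfl⟩
    | .var x => exact .inr ⟨.var x, rfl⟩
  have hinj : ∀ u w : Name, u.subst .var Nat.succ = w.subst .var Nat.succ → u = w := by
    intro u w h; cases u <;> cases w <;> simp_all [Name.subst]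
  have h0 : ∀ (u : Name) p, u.subst .var Nat.succ ≠ .ep 0 p := by
    intro u p h; cases u <;> simp [Name.subst] at h
  have hp : ∀ p, (Name.ep 0 p).subst (liftChan v) (liftRen c) = .ep 0 p := fun p => rfl
  refine ⟨fun u hu => ?_, fun u w hu hw e => ?_, fun w hw => ?_⟩
  · obtain ⟨p, rfl⟩ | ⟨u, rfl⟩ := hcases u
    · cases p <;> rfl
    · rw [hE] at hu
      rw [hθ, hE, hE, h.map u hu]
  · obtain ⟨p, rfl⟩ | ⟨u, rfl⟩ := hcases u <;> obtain ⟨q, rfl⟩ | ⟨w, rfl⟩ := hcases w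
    · exact e
    · rw [hθ] at e; exact absurd e.symm (h0 _ _)
    · rw [hθ] at e; exact absurd e (h0 _ _)
    · rw [hθ, hθ] at e
      rw [hE] at hu hw
      rw [h.inj u w hu hw (hinj _ _ e)]
  · obtain ⟨p, rfl⟩ | ⟨w, rfl⟩ := hcases w
    · exact ⟨.ep 0 p, rfl, by cases p <;> exact hw⟩
    · rw [hE] at hw
      obtain ⟨u, rfl, hu⟩ := h.surj w hw
      exact ⟨_, hθ u, by rwa [hE]⟩

/-! ### Semantic typing -/

/-- The variables of `u` are among the first `k`. -/
def Name.Scoped (k : ℕ) : Name → Prop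
  | .var x => x < k
  | .ep _ _ => True

theorem Name.Scoped.subst {k k' : ℕ} {u : Name} (hu : u.Scoped k) {v : ℕ → Name} {c : ℕ → ℕ}
    (hv : ∀ x < k, (v x).Scoped k') : (u.subst v c).Scoped k' := by
  cases u with
  | var x => exact hv x hu
  | ep a p => trivial

/-- Semantic typing of user processes with `k` variables in scope.  Recursions are unfolded along the
derivation; below at least `n` unfoldings any process is accepted in an environment without usable
names.  The number `s` is the size of the derivation. -/
inductive WT : ℕ → ℕ → ℕ → SEnv → Proc → Prop
  -- A process that holds a usable endpoint is never garbage, even at budget `0`.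
  | garbage {k E} (P) : (∀ u, E u = .fin) → WT k 0 0 E P
  | idle {k n E} : (∀ u, E u = .fin) → WT k n 0 E .idle
  | inp {k n s E P u S T} {α β : ℕ} :
      E u = .inp α β S T →
      (∀ v, v ≠ u → (β : ℕ∞) < (E v).obl) →
      WT (k + 1) n s (SEnv.pushVar S (Function.update E u T)) P →
      WT k n (s + 1) E (.inp u P)
  | out {k n s E P u v S T} {α β : ℕ} :
      E u = .out α β S T → S ≠ .fin → v ≠ u → v.Scoped k → E v = S →
      (∀ w, w ≠ u → (β : ℕ∞) < (E w).obl) →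
      WT k n s (Function.update (Function.update E u T) v .fin) P →
      WT k n (s + 1) E (.out u v P)
  -- A message of type `end` transfers nothing, so `v` only has to be in scope; it may be in use
  -- elsewhere or even equal `u`. This keeps typing stable under `Push`.
  | out_fin {k n s E P u v T} {α β : ℕ} :
      E u = .out α β .fin T → v.Scoped k →
      (∀ w, w ≠ u → (β : ℕ∞) < (E w).obl) →
      WT k n s (Function.update E u T) P →
      WT k n (s + 1) E (.out u v P)
  | par {k n s₁ s₂ E₁ E₂ E P Q} :
      Split E₁ E₂ E → WT k n s₁ E₁ P → WT k n s₂ E₂ Q → WT k n (s₁ + s₂) E (.par P Q)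
  | new {k n s E P} (T : Tree) : WT k n s (E.pushChan T) P → WT k n s E (.new P)
  -- The subtraction is truncated: at budget `0` unfolding is free and is paid for by the size
  -- alone.
  | recur {k n s E P} :
      WT k (n - 1) s E (P.instProc (.recur ⊤ P)) → WT k n (s + 1) E (.recur ⊤ P)

theorem WT.mono {k n s : ℕ} {E : SEnv} {P : Proc} (h : WT k n s E P) :
    ∀ m ≤ n, WT k m s E P := by
  induction h with
  | garbage P h => intro m hm; rw [Nat.le_zero.mp hm]; exact .garbage P h
  | idle h => exact fun m _ => .idle h
  | inp hu ho _ ih => exact fun m hm => .inp hu ho (ih m hm)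
  | out hu hS huv hsc hv ho _ ih => exact fun m hm => .out hu hS huv hsc hv ho (ih m hm)
  | out_fin hu hv ho _ ih => exact fun m hm => .out_fin hu hv ho (ih m hm)
  | par hs _ _ ih₁ ih₂ => exact fun m hm => .par hs (ih₁ m hm) (ih₂ m hm)
  | new T _ ih => exact fun m hm => .new T (ih m hm)
  | recur _ ih => exact fun m hm => .recur (ih _ (by omega))

theorem SEnv.pushChan_eq_fin {E : SEnv} (h : ∀ u, E u = .fin) (u : Name) :
    E.pushChan .fin u = .fin := by
  match u with
  | .var x => exact h _
  | .ep 0 .pos => rfl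
  | .ep 0 .neg => exact Tree.dual_fin
  | .ep (a + 1) p => exact h _

theorem WT.par_inv {k n s : ℕ} {E : SEnv} {P Q : Proc} (h : WT k n s E (.par P Q)) :
    ∃ E₁ E₂ s₁ s₂, s₁ + s₂ = s ∧ Split E₁ E₂ E ∧ WT k n s₁ E₁ P ∧ WT k n s₂ E₂ Q := by
  cases h with
  | garbage _ h => exact ⟨E, E, 0, 0, rfl, Split.of_fin h E, .garbage _ h, .garbage _ h⟩
  | par hs h₁ h₂ => exact ⟨_, _, _, _, rfl, hs, h₁, h₂⟩

theorem WT.new_inv {k n s : ℕ} {E : SEnv} {P : Proc} (h : WT k n s E (.new P)) :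
    ∃ T, WT k n s (E.pushChan T) P := by
  cases h with
  | garbage _ h => exact ⟨.fin, .garbage _ (SEnv.pushChan_eq_fin h)⟩
  | new T h => exact ⟨T, h⟩

theorem WT.idle_inv {k n s : ℕ} {E : SEnv} (h : WT k n s E .idle) :
    s = 0 ∧ ∀ u, E u = .fin := by
  cases h with
  | garbage _ h => exact ⟨rfl, h⟩
  | idle h => exact ⟨rfl, h⟩

theorem Push.obl {θ : Name → Name} {E E' : SEnv} (h : Push θ E E') {u : Name} {β : ℕ}
    (ho : ∀ v, v ≠ u → (β : ℕ∞) < (E v).obl) (w : Name) (hw : w ≠ θ u) :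
    (β : ℕ∞) < (E' w).obl := by
  by_cases hf : E' w = .fin
  · rw [hf]; exact ENat.natCast_lt_top β
  · obtain ⟨v, rfl, hv⟩ := h.surj w hf
    rw [h.map v hv]
    exact ho v fun e => hw (by rw [e])

theorem WT.ren {k n s : ℕ} {E : SEnv} {P : Proc} (H : WT k n s E P) :
    ∀ {k' E'} (v : ℕ → Name) (c h : ℕ → ℕ), Push (Name.subst v c) E E' →
      (∀ x < k, (v x).Scoped k') → WT k' n s E' (P.ren v c h) := by
  induction H with
  | garbage P hE => exact fun v c h hp _ => .garbage _ (hp.eq_fin hE)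
  | idle hE => exact fun v c h hp _ => .idle (hp.eq_fin hE)
  | @inp k n s E P u S T α β hu ho _ ih =>
    intro k' E' v c h hp hv
    have hne : E u ≠ .fin := by rw [hu]; exact Tree.inp_ne_fin
    refine .inp ((hp.map u hne).trans hu) (hp.obl ho) (ih _ _ _ ((hp.update hne T).pushVar S) ?_)
    rintro (_ | x) hx
    · exact Nat.succ_pos _
    · have := hv x (by omega)
      simp only [liftVar]
      cases hvx : v x with
      | var y => rw [hvx] at this; exact Nat.succ_lt_succ this
      | ep a p => trivial
  | @out k n s E P u w S T α β hu hS huv hsc hw ho _ ih =>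
    intro k' E' v c h hp hv
    have hne : E u ≠ .fin := by rw [hu]; exact Tree.out_ne_fin
    have hne' : E w ≠ .fin := by rwa [hw]
    refine .out ((hp.map u hne).trans hu) hS (fun e => huv (hp.inj _ _ hne' hne e))
      (hsc.subst hv)
      ((hp.map w hne').trans hw) (hp.obl ho) (ih _ _ _ ((hp.update hne T).update ?_ _) hv)
    rwa [Function.update_of_ne huv]
  | @out_fin k n s E P u w T α β hu hw ho _ ih =>
    intro k' E' v c h hp hv
    have hne : E u ≠ .fin := by rw [hu]; exact Tree.out_ne_fin
    exact .out_fin ((hp.map u hne).trans hu) (hw.subst hv) (hp.obl ho)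
      (ih _ _ _ (hp.update hne T) hv)
  | par hs _ _ ih₁ ih₂ =>
    intro k' E' v c h hp hv
    obtain ⟨E₁', E₂', hs', hp₁, hp₂⟩ := hp.split hs
    exact .par hs' (ih₁ _ _ _ hp₁ hv) (ih₂ _ _ _ hp₂ hv)
  | new T _ ih =>
    intro k' E' v c h hp hv
    refine .new T (ih _ _ _ (hp.pushChan T) fun x hx => ?_)
    have := hv x hx
    simp only [liftChan]
    cases hvx : v x with
    | var y => rw [hvx] at this; exact this
    | ep a p => trivial
  | recur _ ih =>
    intro k' E' v c h hp hv
    have := ih v c h hp hv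
    rw [Proc.instProc_ren] at this
    exact .recur this

/-- A derivation has to use up every usable name, so each of them is mentioned by the process, and a
renamed process mentions renamed names only. This supplies the side condition of scope extrusion
when it is read from right to left. -/
theorem WT.exists_of_ren {k n s : ℕ} {E : SEnv} {P' : Proc} (H : WT k n s E P') :
    ∀ (P : Proc) (v : ℕ → Name) (c h : ℕ → ℕ), P' = P.ren v c h →
      ∀ w, E w ≠ .fin → ∃ u : Name, w = u.subst v c := by
  induction H with
  | garbage P hE => exact fun _ _ _ _ _ w hw => absurd (hE w) hw
  | idle hE => exact fun _ _ _ _ _ w hw => absurd (hE w) hw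
  | @inp k n s E P' u S T α β hu ho _ ih =>
    intro P v c h he w hw
    cases P <;> simp only [Proc.ren, reduceCtorEq, Proc.inp.injEq] at he
    rename_i u' P
    obtain ⟨rfl, he⟩ := he
    by_cases hwu : w = u'.subst v c
    · exact ⟨_, hwu⟩
    obtain ⟨x, hx⟩ := ih P _ _ _ he (w.subst (fun x => .var (x + 1)) id) (by
      have : SEnv.pushVar S (Function.update E (u'.subst v c) T)
          (w.subst (fun x => .var (x + 1)) id) = E w := by
        cases w <;> exact Function.update_of_ne hwu _ _
      rwa [this])
    match x with
    | .var 0 => cases w <;> simp [Name.subst, liftVar] at hx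
    | .var (x + 1) =>
      refine ⟨.var x, ?_⟩
      simp only [Name.subst, liftVar] at hx ⊢
      cases w <;> cases hvx : v x <;> simp_all [Name.subst]
    | .ep a p =>
      refine ⟨.ep a p, ?_⟩
      cases w <;> simp_all [Name.subst]
  | @out k n s E P' u x S T α β hu hS huv _ hx ho _ ih =>
    intro P v c h he w hw
    cases P <;> simp only [Proc.ren, reduceCtorEq, Proc.out.injEq] at he
    rename_i u' x' P
    obtain ⟨rfl, rfl, he⟩ := he
    by_cases hwu : w = u'.subst v c
    · exact ⟨_, hwu⟩
    by_cases hwx : w = x'.subst v c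
    · exact ⟨_, hwx⟩
    exact ih P _ _ _ he w (by
      rwa [Function.update_of_ne hwx, Function.update_of_ne hwu])
  | @out_fin k n s E P' u x T α β hu hx ho _ ih =>
    intro P v c h he w hw
    cases P <;> simp only [Proc.ren, reduceCtorEq, Proc.out.injEq] at he
    rename_i u' x' P
    obtain ⟨rfl, rfl, he⟩ := he
    by_cases hwu : w = u'.subst v c
    · exact ⟨_, hwu⟩
    exact ih P _ _ _ he w (by rwa [Function.update_of_ne hwu])
  | par hs _ _ ih₁ ih₂ =>
    intro P v c h he w hw
    cases P <;> simp only [Proc.ren, reduceCtorEq, Proc.par.injEq] at he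
    obtain ⟨he₁, he₂⟩ := he
    rcases hs w with ⟨_, e⟩ | ⟨_, e⟩
    · exact ih₂ _ _ _ _ he₂ w (by rwa [← e])
    · exact ih₁ _ _ _ _ he₁ w (by rwa [← e])
  | new T _ ih =>
    intro P v c h he w hw
    cases P <;> simp only [Proc.ren, reduceCtorEq, Proc.new.injEq] at he
    obtain ⟨x, hx⟩ := ih _ _ _ _ he (w.subst .var Nat.succ) (by cases w <;> exact hw)
    match x with
    | .var x =>
      refine ⟨.var x, ?_⟩
      simp only [Name.subst, liftChan] at hx ⊢
      cases w <;> cases hvx : v x <;> simp_all [Name.subst]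
    | .ep 0 p => cases w <;> simp [Name.subst, liftRen] at hx
    | .ep (a + 1) p =>
      refine ⟨.ep a p, ?_⟩
      cases w <;> simp_all [Name.subst, liftRen]
  | recur _ ih =>
    intro P v c h he w hw
    cases P <;> simp only [Proc.ren, reduceCtorEq, Proc.recur.injEq] at he
    rename_i ι P
    obtain ⟨rfl, rfl⟩ := he
    exact ih (P.instProc (.recur ⊤ P)) v c h (Proc.instProc_ren P (.recur ⊤ P) v c h).symm w hw

/-! ### Structural congruence preserves semantic typing -/

theorem Push.of_leftInverse {θ θ' : Name → Name} {E E' : SEnv} (h : ∀ u, E' (θ u) = E u)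
    (hθ : Function.LeftInverse θ' θ) (hs : ∀ w, E' w ≠ .fin → θ (θ' w) = w) : Push θ E E' :=
  ⟨fun u _ => h u, fun _ _ _ _ e => hθ.injective e,
    fun w hw => ⟨θ' w, hs w hw, by rwa [← h, hs w hw]⟩⟩

theorem Push.shiftVar (E : SEnv) :
    Push (Name.subst (fun x => .var (x + 1)) id) E (E.pushVar .fin) := by
  refine .of_leftInverse (θ' := Name.subst (fun x => .var (x - 1)) id) (fun u => ?_) (fun u => ?_)
    fun w hw => ?_
  · cases u <;> rfl
  · cases u <;> rfl
  · match w with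
    | .var 0 => exact absurd rfl hw
    | .var (x + 1) => rfl
    | .ep a p => rfl

theorem Push.shiftChan (E : SEnv) : Push (Name.subst .var Nat.succ) E (E.pushChan .fin) := by
  refine .of_leftInverse (θ' := Name.subst .var Nat.pred) (fun u => ?_) (fun u => ?_)
    fun w hw => ?_
  · cases u <;> rfl
  · cases u <;> rfl
  · match w with
    | .var x => rfl
    | .ep 0 .pos => exact absurd rfl hw
    | .ep 0 .neg => exact absurd Tree.dual_fin hw
    | .ep (a + 1) p => rfl

theorem WT.shiftChan {k n s : ℕ} {E : SEnv} {P : Proc} (H : WT k n s E P) :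
    WT k n s (E.pushChan .fin) P.shiftChan :=
  H.ren _ _ _ (Push.shiftChan E) fun _ hx => hx

theorem WT.new_swap {k n s : ℕ} {E : SEnv} {P : Proc} (H : WT k n s E (.new (.new P))) :
    WT k n s E (.new (.new P.swapChan)) := by
  obtain ⟨T, H⟩ := H.new_inv
  obtain ⟨U, H⟩ := H.new_inv
  refine .new U (.new T (H.ren _ _ _ (.of_leftInverse (θ' := Name.subst .var (Equiv.swap 0 1))
    ?_ ?_ ?_) fun _ hx => hx))
  · intro u
    match u with
    | .var x => rfl
    | .ep 0 p => cases p <;> rfl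
    | .ep 1 p => cases p <;> rfl
    | .ep (a + 2) p => simp [Name.subst, SEnv.pushChan, Equiv.swap_apply_of_ne_of_ne]
  · intro u; cases u <;> simp [Name.subst]
  · intro u _; cases u <;> simp [Name.subst]

theorem WT.new_par {k n s : ℕ} {E : SEnv} {P Q : Proc} :
    WT k n s E (.par (.new P) Q) ↔ WT k n s E (.new (.par P Q.shiftChan)) := by
  constructor
  · intro H
    obtain ⟨E₁, E₂, s₁, s₂, rfl, hs, H₁, H₂⟩ := H.par_inv
    obtain ⟨T, H₁⟩ := H₁.new_inv
    exact .new T (.par (hs.pushChan T) H₁ H₂.shiftChan)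
  · intro H
    obtain ⟨T, H⟩ := H.new_inv
    obtain ⟨E₁, E₂, s₁, s₂, rfl, hs, H₁, H₂⟩ := H.par_inv
    -- The shifted `Q` cannot mention the restricted channel, so both endpoints belong to the
    -- component of `P`.
    have h0 : ∀ p, E₂ (.ep 0 p) = .fin := by
      intro p
      by_contra hne
      obtain ⟨u, hu⟩ := H₂.exists_of_ren Q .var Nat.succ id rfl _ hne
      cases u <;> simp [Name.subst] at hu
    have hE₁ : E₁ = SEnv.pushChan T fun u => E₁ (u.subst .var Nat.succ) := by
      funext u
      match u with
      | .var x => rfl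
      | .ep 0 .pos => exact (hs.eq_left (h0 _)).symm
      | .ep 0 .neg => exact (hs.eq_left (h0 _)).symm
      | .ep (a + 1) p => rfl
    rw [hE₁] at H₁
    have H₂' : WT k n s₂ (fun u => E₂ (u.subst .var Nat.succ)) Q := by
      have := H₂.ren .var Nat.pred id (k' := k) (E' := fun u => E₂ (u.subst .var Nat.succ))
        ⟨fun u hu => ?_, fun u v hu hv e => ?_, fun w hw => ⟨_, ?_, hw⟩⟩ fun _ hx => hx
      · rw [Proc.shiftChan, Proc.ren_ren] at this
        exact Q.ren_id ▸ this
      · match u with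
        | .var x => rfl
        | .ep 0 p => exact absurd (h0 p) hu
        | .ep (a + 1) p => rfl
      · match u, v with
        | .ep 0 p, _ => exact absurd (h0 p) hu
        | _, .ep 0 p => exact absurd (h0 p) hv
        | .var x, .var y => exact e
        | .var x, .ep (a + 1) p => exact nomatch e
        | .ep (a + 1) p, .var x => exact nomatch e
        | .ep (a + 1) p, .ep (b + 1) q => simpa [Name.subst] using e
      · cases w <;> rfl
    refine .par (fun u => ?_) (.new T H₁) H₂'
    have := hs (u.subst .var Nat.succ)
    cases u <;> exact this

/-- Congruent recursions have congruent unfoldings, but this new congruence is not a premise of the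
old one. Hence the outer induction on the size, around the one on the congruence; it works because
the equivalence preserves the size exactly. -/
theorem WT.structCong_iff_of_le (N : ℕ) : ∀ {P Q : Proc}, StructCong P Q →
    ∀ {k n s E}, s ≤ N → (WT k n s E P ↔ WT k n s E Q) := by
  induction N using Nat.strong_induction_on with
  | _ N IH =>
  intro P Q H
  induction H with
  | refl P => exact fun _ => Iff.rfl
  | symm _ ih => exact fun hs => (ih hs).symm
  | trans _ _ ih₁ ih₂ => exact fun hs => (ih₁ hs).trans (ih₂ hs)
  | inp u _ ih =>
    intro k n s E hs
    constructor <;> intro H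
    · cases H with
      | garbage _ h => exact .garbage _ h
      | inp hu ho h => exact .inp hu ho ((ih (by omega)).mp h)
    · cases H with
      | garbage _ h => exact .garbage _ h
      | inp hu ho h => exact .inp hu ho ((ih (by omega)).mpr h)
  | out u v _ ih =>
    intro k n s E hs
    constructor <;> intro H
    · cases H with
      | garbage _ h => exact .garbage _ h
      | out hu hS huv hsc hv ho h => exact .out hu hS huv hsc hv ho ((ih (by omega)).mp h)
      | out_fin hu hsc ho h => exact .out_fin hu hsc ho ((ih (by omega)).mp h)
    · cases H with
      | garbage _ h => exact .garbage _ h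
      | out hu hS huv hsc hv ho h => exact .out hu hS huv hsc hv ho ((ih (by omega)).mpr h)
      | out_fin hu hsc ho h => exact .out_fin hu hsc ho ((ih (by omega)).mpr h)
  | par _ _ ih₁ ih₂ =>
    intro k n s E hs
    constructor <;> intro H <;> obtain ⟨E₁, E₂, s₁, s₂, rfl, h, H₁, H₂⟩ := H.par_inv
    · exact .par h ((ih₁ (by omega)).mp H₁) ((ih₂ (by omega)).mp H₂)
    · exact .par h ((ih₁ (by omega)).mpr H₁) ((ih₂ (by omega)).mpr H₂)
  | new _ ih =>
    intro k n s E hs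
    constructor <;> intro H <;> obtain ⟨T, H⟩ := H.new_inv
    · exact .new T ((ih hs).mp H)
    · exact .new T ((ih hs).mpr H)
  | recur ι h _ =>
    intro k n s E hs
    constructor <;> intro H <;> cases H
    · rename_i h; exact .garbage _ h
    · rename_i s H
      exact .recur ((IH s (by omega) (h.instProc (.recur ⊤ h)) le_rfl).mp H)
    · rename_i h; exact .garbage _ h
    · rename_i s H
      exact .recur ((IH s (by omega) (h.instProc (.recur ⊤ h)) le_rfl).mpr H)
  | par_idle P =>
    intro k n s E hs
    constructor <;> intro H
    · obtain ⟨E₁, E₂, s₁, s₂, rfl, h, H₁, H₂⟩ := H.par_inv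
      obtain ⟨rfl, h₁⟩ := H₁.idle_inv
      rw [h.eq_fin h₁, Nat.zero_add]
      exact H₂
    · have := WT.par (Split.of_fin (E₁ := fun _ => .fin) (fun _ => rfl) E) (.idle fun _ => rfl) H
      rwa [Nat.zero_add] at this
  | par_comm P Q =>
    intro k n s E hs
    constructor <;> intro H <;> obtain ⟨E₁, E₂, s₁, s₂, rfl, h, H₁, H₂⟩ := H.par_inv <;>
      exact Nat.add_comm s₁ s₂ ▸ .par h.symm H₂ H₁
  | par_assoc P Q R =>
    intro k n s E hs
    constructor <;> intro H <;> obtain ⟨E₁, E₂, s₁, s₂, rfl, h, H₁, H₂⟩ := H.par_inv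
    · obtain ⟨E₃, E₄, s₃, s₄, rfl, h', H₃, H₄⟩ := H₂.par_inv
      obtain ⟨E', h₁, h₂⟩ := h.assoc h'
      exact Nat.add_assoc s₁ s₃ s₄ ▸ .par h₂ (.par h₁ H₁ H₃) H₄
    · obtain ⟨E₃, E₄, s₃, s₄, rfl, h', H₃, H₄⟩ := H₁.par_inv
      obtain ⟨E', h₁, h₂⟩ := h.symm.assoc h'.symm
      exact (Nat.add_assoc s₃ s₄ s₂).symm ▸ .par h₂.symm H₃ (.par h₁.symm H₄ H₂)
  | new_swap P =>
    intro k n s E hs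
    exact ⟨WT.new_swap, fun H => by simpa using H.new_swap⟩
  | new_par P Q => exact fun _ => WT.new_par

theorem WT.structCong {k n s : ℕ} {E : SEnv} {P Q : Proc} (H : WT k n s E P)
    (h : StructCong P Q) : WT k n s E Q :=
  (WT.structCong_iff_of_le s h le_rfl).mp H

/-! ### Subject reduction -/

@[simp] theorem Polarity.co_co (p : Polarity) : p.co.co = p := by cases p <;> rfl

@[simp] theorem Polarity.co_ne (p : Polarity) : p.co ≠ p := by cases p <;> exact nofun

@[simp] theorem Polarity.ne_co (p : Polarity) : p ≠ p.co := p.co_ne.symm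

theorem Polarity.eq_or_eq_co (p q : Polarity) : q = p ∨ q = p.co := by
  cases p <;> cases q <;> simp [Polarity.co]

@[simp] theorem SEnv.pushChan_co (T : Tree) (E : SEnv) (p : Polarity) :
    E.pushChan T (.ep 0 p.co) = (E.pushChan T (.ep 0 p)).dual := by
  cases p
  · rfl
  · exact (Tree.dual_dual T).symm

/-- The evolution of environments: the two endpoints of at most one channel exchange a message. -/
def Step (E E' : SEnv) : Prop :=
  E' = E ∨ ∃ c r α β S T, E (.ep c r) = .out α β S T ∧ E (.ep c r.co) = .inp β α S T.dual ∧
    E' = Function.update (Function.update E (.ep c r) T) (.ep c r.co) T.dual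

/-- Whenever both endpoints of a channel are used, their types are dual. -/
def SEnv.Coherent (E : SEnv) : Prop :=
  ∀ a p, E (.ep a p) ≠ .fin → E (.ep a p.co) ≠ .fin → E (.ep a p.co) = (E (.ep a p)).dual

theorem Split.coherent {E₁ E₂ E : SEnv} (h : Split E₁ E₂ E) (hE : E.Coherent) : E₁.Coherent := by
  intro a p h₁ h₂
  rw [← h.left_eq h₁, ← h.left_eq h₂]
  exact hE a p (by rwa [h.left_eq h₁]) (by rwa [h.left_eq h₂])

theorem SEnv.Coherent.pushChan {E : SEnv} (hE : E.Coherent) (T : Tree) :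
    (E.pushChan T).Coherent := by
  intro a p h₁ h₂
  cases a with
  | zero => exact SEnv.pushChan_co T E p
  | succ a => exact hE a p h₁ h₂

/-- An exchange on the innermost channel is invisible outside: only the type recorded for that
channel changes. -/
theorem Step.of_pushChan {E E'' : SEnv} {T : Tree} (h : Step (E.pushChan T) E'') :
    ∃ T' E', E'' = E'.pushChan T' ∧ Step E E' := by
  rcases h with rfl | ⟨c, r, α, β, S, U, h₁, h₂, rfl⟩
  · exact ⟨T, E, rfl, .inl rfl⟩
  cases c with
  | zero =>
    -- `pushChan` records the type of the positive endpoint, whereas `U` is the new type of the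
    -- sender `r`.
    refine ⟨if r = .pos then U else U.dual, E, ?_, .inl rfl⟩
    funext u
    match u with
    | .var x => rfl
    | .ep 0 .pos => cases r <;> simp [Polarity.co, SEnv.pushChan]
    | .ep 0 .neg => cases r <;> simp [Polarity.co, SEnv.pushChan]
    | .ep (a + 1) p => simp [Polarity.co, SEnv.pushChan]
  | succ c =>
    refine ⟨T, _, ?_, .inr ⟨c, r, α, β, S, U, h₁, h₂, rfl⟩⟩
    funext u
    match u with
    | .var x => simp [SEnv.pushChan]
    | .ep 0 p => cases p <;> simp [SEnv.pushChan]
    | .ep (a + 1) p => simp [SEnv.pushChan, Function.update_apply]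

theorem Step.split {E₁ E₁' E₂ E : SEnv} (hs : Split E₁ E₂ E) (h : Step E₁ E₁') :
    ∃ E', Split E₁' E₂ E' ∧ Step E E' := by
  rcases h with rfl | ⟨c, r, α, β, S, U, h₁, h₂, rfl⟩
  · exact ⟨E, hs, .inl rfl⟩
  have h₁' : E₁ (.ep c r) ≠ .fin := by rw [h₁]; exact Tree.out_ne_fin
  have h₂' : E₁ (.ep c r.co) ≠ .fin := by rw [h₂]; exact Tree.inp_ne_fin
  refine ⟨_, fun u => ?_, .inr ⟨c, r, α, β, S, U, (hs.left_eq h₁').trans h₁,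
    (hs.left_eq h₂').trans h₂, rfl⟩⟩
  by_cases hu : u = .ep c r.co
  · subst hu; exact .inr ⟨hs.right_eq_fin h₂', by simp⟩
  by_cases hu' : u = .ep c r
  · subst hu'; exact .inr ⟨hs.right_eq_fin h₁', by simp [hu]⟩
  · simpa [hu, hu'] using hs u

/-- The alternatives in `hS` are the two kinds of reception: the receiver becomes the owner of `w`
at type `S`, or the message has type `end` and the type of `w` is unaffected. -/
theorem WT.instName {k n s : ℕ} {E E' : SEnv} {S : Tree} {P : Proc} {w : Name}
    (H : WT (k + 1) n s (E.pushVar S) P) (hw : w.Scoped k) (hE : ∀ u, u ≠ w → E' u = E u)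
    (hS : E' w = S ∧ E w = .fin ∨ E' w = E w ∧ S = .fin) : WT k n s E' (P.instName w) := by
  refine H.ren _ _ _ ⟨fun u hu => ?_, fun u v hu hv e => ?_, fun v hv => ?_⟩ ?_
  · have aux : ∀ v, E v ≠ .fin → E' v = E v := by
      intro v hv
      by_cases hvw : v = w
      · subst hvw
        rcases hS with ⟨_, h⟩ | ⟨h, _⟩
        · exact absurd h hv
        · exact h
      · exact hE v hvw
    match u with
    | .var 0 =>
      rcases hS with ⟨h, _⟩ | ⟨_, h⟩
      · exact h
      · exact absurd h hu
    | .var (x + 1) => exact aux _ hu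
    | .ep a p => exact aux _ hu
  · have aux : E.pushVar S (.var 0) ≠ .fin → E w = .fin := by
      intro h
      rcases hS with ⟨_, h'⟩ | ⟨_, h'⟩
      · exact h'
      · exact absurd h' h
    match u, v with
    | .var 0, .var 0 => rfl
    | .var 0, .var (x + 1) => exact absurd ((congrArg E e).symm.trans (aux hu)) hv
    | .var 0, .ep a p => exact absurd ((congrArg E e).symm.trans (aux hu)) hv
    | .var (x + 1), .var 0 => exact absurd ((congrArg E e).trans (aux hv)) hu
    | .ep a p, .var 0 => exact absurd ((congrArg E e).trans (aux hv)) hu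
    | .var (x + 1), .var (y + 1) => simpa [Name.subst] using e
    | .var (x + 1), .ep a p => exact nomatch e
    | .ep a p, .var (x + 1) => exact nomatch e
    | .ep a p, .ep b q => exact e
  · by_cases hf : E v = .fin
    · have hvw : v = w := by
        by_contra hvw
        exact hv ((hE v hvw).trans hf)
      subst hvw
      refine ⟨.var 0, rfl, ?_⟩
      rcases hS with ⟨h, _⟩ | ⟨h, _⟩
      · rwa [h] at hv
      · exact absurd (h.trans hf) hv
    · cases v with
      | var x => exact ⟨.var (x + 1), rfl, hf⟩
      | ep a p => exact ⟨.ep a p, rfl, hf⟩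
  · rintro (_ | x) hx
    · exact hw
    · exact Nat.lt_of_succ_lt_succ hx

/-- The typing of `v` moves from sender to receiver. The rules for both prefixes vanish from the
derivation, so the size drops while the budget stays the same. -/
theorem WT.comm {k n s₁ s₂ : ℕ} {E₁ E₂ E : SEnv} {a : ℕ} {p : Polarity} {v : Name} {P Q : Proc}
    (H₁ : WT k n s₁ E₁ (.out (.ep a p) v P)) (H₂ : WT k n s₂ E₂ (.inp (.ep a p.co) Q))
    (hs : Split E₁ E₂ E) (hne : E₁ (.ep a p) ≠ .fin)
    (hd : E₂ (.ep a p.co) = (E₁ (.ep a p)).dual) :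
    ∃ E' s', Step E E' ∧ WT k n s' E' (.par P (Q.instName v)) ∧ s' < s₁ + s₂ := by
  have hne₂ : E₂ (.ep a p.co) ≠ .fin := by rwa [hd, Ne, Tree.dual_eq_fin]
  have h₂₁ : E₁ (.ep a p.co) = .fin := hs.symm.right_eq_fin hne₂
  have h₁₂ : E₂ (.ep a p) = .fin := hs.right_eq_fin hne
  cases H₂ with
  | garbage _ h => exact absurd (h _) hne₂
  | @inp _ _ s₂ _ _ _ S₂ T₂ α₂ β₂ hu₂ ho₂ H₂ =>
  have hE := hs.left_eq hne
  have hE' := hs.symm.left_eq hne₂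
  cases H₁ with
  | garbage _ h => exact absurd (h _) hne
  | @out _ _ s₁ _ _ _ _ S T α β hu hS huv hsc hv ho H₁ =>
    rw [hu, Tree.dual_out, hu₂] at hd
    obtain ⟨rfl, rfl, rfl, rfl⟩ := Tree.inp_inj hd
    have hvn : E₁ v ≠ .fin := by rwa [hv]
    have hvc : v ≠ .ep a p.co := by rintro rfl; exact hvn h₂₁
    refine ⟨_, s₁ + s₂, .inr ⟨a, p, _, _, _, _, hE.trans hu, hE'.trans hu₂, rfl⟩,
      .par (E₂ := Function.update (Function.update E₂ (.ep a p.co) T.dual) v S₂) ?_ H₁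
        (H₂.instName hsc ?_ (.inl ⟨by simp, ?_⟩)), by omega⟩
    · intro u
      by_cases hu₁ : u = v
      · subst hu₁; left; simp [hvc, huv, hs.left_eq hvn, hv]
      by_cases hu₂ : u = .ep a p.co
      · subst hu₂; left; simp [hu₁, h₂₁]
      by_cases hu₃ : u = .ep a p
      · subst hu₃; right; simp [hu₁, hu₂, h₁₂]
      · simpa [hu₁, hu₂, hu₃] using hs u
    · intro u hu; simp [hu]
    · rw [Function.update_of_ne hvc]; exact hs.right_eq_fin hvn
  | @out_fin _ _ s₁ _ _ _ _ T α β hu hv ho H₁ =>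
    rw [hu, Tree.dual_out, hu₂] at hd
    obtain ⟨rfl, rfl, rfl, rfl⟩ := Tree.inp_inj hd
    refine ⟨_, s₁ + s₂, .inr ⟨a, p, _, _, _, _, hE.trans hu, hE'.trans hu₂, rfl⟩,
      .par (E₂ := Function.update E₂ (.ep a p.co) T.dual) ?_ H₁
        (H₂.instName hv (fun _ _ => rfl) (.inr ⟨rfl, rfl⟩)), by omega⟩
    intro u
    by_cases hu₂ : u = .ep a p.co
    · subst hu₂; left; simp [h₂₁]
    by_cases hu₃ : u = .ep a p
    · subst hu₃; right; simp [h₁₂]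
    · simpa [hu₂, hu₃] using hs u

/-- A positive budget excludes garbage at the redex, so two communicating prefixes own their
subjects and coherence makes the types dual. An unfolding spends the unit of budget. -/
theorem WT.red {P P' : Proc} (h : Red P P') : ∀ {k n s E}, WT k (n + 1) s E P → E.Coherent →
    ∃ E' s', Step E E' ∧ WT k n s' E' P' := by
  induction h with
  | comm a p c q P Q =>
    intro k n s E H hE
    obtain ⟨E₁, E₂, s₁, s₂, rfl, hs, H₁, H₂⟩ := H.par_inv
    have h₁ : E₁ (.ep a p) ≠ .fin := by
      cases H₁ with
      | out hu => rw [hu]; exact Tree.out_ne_fin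
      | out_fin hu => rw [hu]; exact Tree.out_ne_fin
    have h₂ : E₂ (.ep a p.co) ≠ .fin := by
      cases H₂ with
      | inp hu => rw [hu]; exact Tree.inp_ne_fin
    have hd := hE a p (by rwa [hs.left_eq h₁]) (by rwa [hs.symm.left_eq h₂])
    rw [hs.left_eq h₁, hs.symm.left_eq h₂] at hd
    obtain ⟨E', s', hstep, H', _⟩ := (H₁.mono n (by omega)).comm (H₂.mono n (by omega)) hs h₁ hd
    exact ⟨E', s', hstep, H'⟩
  | recur ι P =>
    intro k n s E H hE
    generalize hι : ι + 1 = κ at H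
    cases H with
    | recur H =>
      -- At positive budget only recursions of index `∞` are typed.
      have : ι = ⊤ := by simpa using hι
      subst this
      exact ⟨E, _, .inl rfl, H⟩
  | new _ ih =>
    intro k n s E H hE
    obtain ⟨T, H⟩ := H.new_inv
    obtain ⟨E'', s', hstep, H'⟩ := ih H (hE.pushChan T)
    obtain ⟨T', E', rfl, hstep'⟩ := hstep.of_pushChan
    exact ⟨E', s', hstep', .new T' H'⟩
  | par Q _ ih =>
    intro k n s E H hE
    obtain ⟨E₁, E₂, s₁, s₂, rfl, hs, H₁, H₂⟩ := H.par_inv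
    obtain ⟨E₁', s', hstep, H'⟩ := ih H₁ (hs.coherent hE)
    obtain ⟨E', hs', hstep'⟩ := hstep.split hs
    exact ⟨E', _, hstep', .par hs' H' (H₂.mono n (by omega))⟩
  | struct h _ h' ih =>
    intro k n s E H hE
    obtain ⟨E', s', hstep, H'⟩ := ih (H.structCong h) hE
    exact ⟨E', s', hstep, H'.structCong h'⟩

/-! ### Environments under several restrictions -/

/-- `E'` is `E` under `m` binders for channels. -/
inductive Ext : ℕ → SEnv → SEnv → Prop
  | zero (E) : Ext 0 E E
  | succ {m E E'} (T : Tree) : Ext m (E.pushChan T) E' → Ext (m + 1) E E'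

theorem Ext.apply_ep {m : ℕ} {E E' : SEnv} (h : Ext m E E') (a : ℕ) (p : Polarity) :
    E' (.ep (a + m) p) = E (.ep a p) := by
  induction h generalizing a with
  | zero E => rfl
  | @succ m E E' T _ ih =>
    rw [show a + (m + 1) = a + 1 + m by omega]
    exact ih (a + 1)

theorem WT.news {k n s m : ℕ} {E E' : SEnv} {P : Proc} (h : Ext m E E') (H : WT k n s E' P) :
    WT k n s E (P.news m) := by
  induction h with
  | zero E => exact H
  | succ T _ ih => exact .new T (ih H)

theorem WT.news_inv {k n s m : ℕ} {E : SEnv} {P : Proc} (H : WT k n s E (P.news m)) :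
    ∃ E', Ext m E E' ∧ WT k n s E' P := by
  induction m generalizing E with
  | zero => exact ⟨E, .zero E, H⟩
  | succ m ih =>
    obtain ⟨T, H⟩ := H.new_inv
    obtain ⟨E', h, H⟩ := ih H
    exact ⟨E', .succ T h, H⟩

theorem Ext.step {m : ℕ} {E E' E'' : SEnv} (h : Ext m E E') (hs : Step E' E'') :
    ∃ F, Ext m F E'' ∧ Step E F := by
  induction h with
  | zero E => exact ⟨E'', .zero _, hs⟩
  | succ T _ ih =>
    obtain ⟨F, h, hs'⟩ := ih hs
    obtain ⟨T', F', rfl, hs''⟩ := hs'.of_pushChan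
    exact ⟨F', .succ T' h, hs''⟩

/-- The left component takes all the restricted channels; the right one sees them as unusable, so
its typings are merely shifted. -/
theorem Ext.split {m : ℕ} {E₁ E₁' E₂ E : SEnv} (h : Ext m E₁ E₁') (hs : Split E₁ E₂ E) :
    ∃ E' E₂', Ext m E E' ∧ Ext m E₂ E₂' ∧ Split E₁' E₂' E' ∧
      ∀ {k n s Q}, WT k n s E₂ Q → WT k n s E₂' (Q.shiftChans m) := by
  induction h generalizing E₂ E with
  | zero E₁ => exact ⟨E, E₂, .zero _, .zero _, hs, fun H => by rwa [Proc.shiftChans_zero]⟩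
  | succ T _ ih =>
    obtain ⟨E', E₂', h₁, h₂, hs', H⟩ := ih (hs.pushChan T)
    refine ⟨E', E₂', .succ T h₁, .succ .fin h₂, hs', fun H' => ?_⟩
    rw [← Proc.shiftChans_shiftChan]
    exact H H'.shiftChan

/-! ### Threads -/

/-- The name on which a prefix is waiting. -/
def Proc.subject : Proc → Option Name
  | .inp u _ => some u
  | .out u _ _ => some u
  | _ => none

/-- Prefixes and recursions. -/
def Proc.IsThread : Proc → Prop
  | .inp _ _ => True
  | .out _ _ _ => True
  | .recur _ _ => True
  | _ => False

theorem Proc.subject_shiftChans {P : Proc} {a : ℕ} {p : Polarity}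
    (h : P.subject = some (.ep a p)) (m : ℕ) :
    (P.shiftChans m).subject = some (.ep (a + m) p) := by
  cases P <;> simp_all [Proc.subject, Proc.shiftChans, Proc.ren, Name.subst]

/-- Up to structural congruence, `P` consists of the thread `t` that uses the endpoint `a^p`, and of
the process `R`, below `m` restrictions. -/
def Located (k n s : ℕ) (E : SEnv) (P : Proc) (a : ℕ) (p : Polarity) (m : ℕ) (t R : Proc) : Prop :=
  ∃ E' E₁ E₂ s₁ s₂, StructCong P ((Proc.par t R).news m) ∧ Ext m E E' ∧ Split E₁ E₂ E' ∧
    WT k n s₁ E₁ t ∧ WT k n s₂ E₂ R ∧ s₁ + s₂ = s ∧ E₁ (.ep (a + m) p) ≠ .fin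

theorem Located.par {k n s₁ s₂ : ℕ} {E₁ E₂ E : SEnv} {P Q t R : Proc} {a m : ℕ} {p : Polarity}
    (h : Located k n s₁ E₁ P a p m t R) (H : WT k n s₂ E₂ Q) (hs : Split E₁ E₂ E) :
    Located k n (s₁ + s₂) E (.par P Q) a p m t (.par R (Q.shiftChans m)) := by
  obtain ⟨E₁', F₁, F₂, r₁, r₂, hc, he, hs', H₁, H₂, rfl, hne⟩ := h
  obtain ⟨E', E₂', he', he₂, hs'', hQ⟩ := he.split hs
  obtain ⟨F, hF, hF'⟩ := hs''.symm.assoc hs'.symm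
  refine ⟨E', F₁, F, r₁, r₂ + s₂, ?_, he', hF'.symm, H₁, .par hF.symm H₂ (hQ H), by omega, hne⟩
  exact ((StructCong.par hc (.refl Q)).trans (.news_par m _ _)).trans
    (StructCong.news (.symm (.par_assoc _ _ _)) m)

/-- Splitting gives a usable endpoint to one side of each parallel composition; following that side,
and extruding the restrictions met, leads to the thread that holds it. -/
theorem WT.exists_located {k n s : ℕ} {E : SEnv} {P : Proc} (H : WT k n s E P) :
    ∀ {a p}, E (.ep a p) ≠ .fin → ∃ m t R, t.IsThread ∧ Located k n s E P a p m t R := by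
  have thread : ∀ {k n s E P a p}, P.IsThread → WT k n s E P → E (.ep a p) ≠ .fin →
      ∃ m t R, t.IsThread ∧ Located k n s E P a p m t R := fun {k n s E P a p} ht H hne =>
    ⟨0, P, .idle, ht, E, E, fun _ => .fin, s, 0,
      .symm (.trans (.par_comm _ _) (.par_idle P)), .zero E, (Split.of_fin (fun _ => rfl) E).symm,
      H, .idle fun _ => rfl, rfl, hne⟩
  induction H with
  | garbage P h => exact fun hne => absurd (h _) hne
  | idle h => exact fun hne => absurd (h _) hne
  | inp hu ho H _ => exact thread trivial (.inp hu ho H)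
  | out hu hS huv hsc hv ho H _ => exact thread trivial (.out hu hS huv hsc hv ho H)
  | out_fin hu hsc ho H _ => exact thread trivial (.out_fin hu hsc ho H)
  | @par k n s₁ s₂ E₁ E₂ E P Q hs H₁ H₂ ih₁ ih₂ =>
    intro a p hne
    by_cases h₁ : E₁ (.ep a p) = .fin
    · obtain ⟨m, t, R, ht, h⟩ := ih₂ (a := a) (p := p) (by rwa [← hs.eq_right h₁])
      obtain ⟨E', F₁, F₂, r₁, r₂, hc, h⟩ := h.par H₁ hs.symm
      rw [Nat.add_comm s₂ s₁] at h
      exact ⟨m, t, _, ht, E', F₁, F₂, r₁, r₂, (StructCong.par_comm _ _).trans hc, h⟩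
    · obtain ⟨m, t, R, ht, h⟩ := ih₁ h₁
      exact ⟨m, t, _, ht, h.par H₂ hs⟩
  | new T _ ih =>
    intro a p hne
    obtain ⟨m, t, R, ht, E', F₁, F₂, r₁, r₂, hc, he, hs, H₁, H₂, hr, hne'⟩ :=
      ih (a := a + 1) (p := p) hne
    refine ⟨m + 1, t, R, ht, E', F₁, F₂, r₁, r₂, .new hc, .succ T he, hs, H₁, H₂, hr, ?_⟩
    rwa [show a + (m + 1) = a + 1 + m by omega]
  | recur H _ => exact thread trivial (.recur H)

/-- A usable name rules out garbage, and since no variable is usable the subject must be an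
endpoint. -/
theorem WT.prefix_inv {n s : ℕ} {E : SEnv} {t : Proc} {u : Name} (H : WT 0 n s E t)
    (ht : t.subject = some u) (hE : ∀ x, E (.var x) = .fin) {w : Name} (hw : E w ≠ .fin) :
    ∃ c r, ∃ β : ℕ, u = .ep c r ∧ E u ≠ .fin ∧ (E u).cap = β ∧
      ∀ v, v ≠ u → (β : ℕ∞) < (E v).obl := by
  have key : ∀ {β : ℕ}, E u ≠ .fin → (E u).cap = β →
      (∀ v, v ≠ u → (β : ℕ∞) < (E v).obl) → ∃ c r, ∃ β : ℕ, u = .ep c r ∧ E u ≠ .fin ∧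
        (E u).cap = β ∧ ∀ v, v ≠ u → (β : ℕ∞) < (E v).obl := by
    intro β hne hc ho
    cases u with
    | var x => exact absurd (hE x) hne
    | ep c r => exact ⟨c, r, β, rfl, hne, hc, ho⟩
  cases H with
  | garbage _ h => exact absurd (h w) hw
  | inp hu ho _ =>
    cases ht
    exact key (by rw [hu]; exact Tree.inp_ne_fin) (by rw [hu]; rfl) ho
  | out hu _ _ _ _ ho _ =>
    cases ht
    exact key (by rw [hu]; exact Tree.out_ne_fin) (by rw [hu]; rfl) ho
  | out_fin hu _ ho _ =>
    cases ht
    exact key (by rw [hu]; exact Tree.out_ne_fin) (by rw [hu]; rfl) ho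
  | _ => cases ht

theorem WT.inp_type {k n s : ℕ} {E : SEnv} {P : Proc} {u w : Name} (H : WT k n s E (.inp u P))
    (hw : E w ≠ .fin) : ∃ α β S T, E u = .inp α β S T := by
  cases H with
  | garbage _ h => exact absurd (h w) hw
  | inp hu => exact ⟨_, _, _, _, hu⟩

theorem WT.out_type {k n s : ℕ} {E : SEnv} {P : Proc} {u v w : Name} (H : WT k n s E (.out u v P))
    (hw : E w ≠ .fin) : v.Scoped k ∧ ∃ α β S T, E u = .out α β S T := by
  cases H with
  | garbage _ h => exact absurd (h w) hw
  | out hu _ _ hsc => exact ⟨hsc, _, _, _, _, hu⟩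
  | out_fin hu hsc => exact ⟨hsc, _, _, _, _, hu⟩

theorem Name.Scoped.exists_ep {v : Name} (h : v.Scoped 0) : ∃ c q, v = .ep c q := by
  cases v with
  | var x => exact absurd h (Nat.not_lt_zero x)
  | ep c q => exact ⟨c, q, rfl⟩

theorem Red.par_right {P P' : Proc} (Q : Proc) (h : Red P P') : Red (.par Q P) (.par Q P') :=
  .struct (.par_comm _ _) (.par Q h) (.par_comm _ _)

/-- Duality excludes two inputs or two outputs, and having no variables in scope makes the message
an endpoint, as the reduction rule demands. -/
theorem WT.comm_prefix {n s₁ s₂ : ℕ} {E₁ E₂ E : SEnv} {t₁ t₂ : Proc} {a : ℕ} {p : Polarity}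
    (H₁ : WT 0 n s₁ E₁ t₁) (H₂ : WT 0 n s₂ E₂ t₂) (hs : Split E₁ E₂ E)
    (h₁ : t₁.subject = some (.ep a p)) (h₂ : t₂.subject = some (.ep a p.co))
    (hne : E₁ (.ep a p) ≠ .fin) (hd : E₂ (.ep a p.co) = (E₁ (.ep a p)).dual) :
    ∃ X E' s', Red (.par t₁ t₂) X ∧ Step E E' ∧ WT 0 n s' E' X ∧ s' < s₁ + s₂ := by
  have hne₂ : E₂ (.ep a p.co) ≠ .fin := by rwa [hd, Ne, Tree.dual_eq_fin]
  cases t₁ with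
  | inp u P =>
    cases h₁
    obtain ⟨α, β, S, T, e₁⟩ := H₁.inp_type hne
    cases t₂ with
    | inp u Q =>
      cases h₂
      obtain ⟨_, _, _, _, e₂⟩ := H₂.inp_type hne₂
      rw [e₁, e₂, Tree.dual_inp] at hd
      exact absurd hd Tree.inp_ne_out
    | out u v Q =>
      cases h₂
      obtain ⟨c, q, rfl⟩ := (H₂.out_type hne₂).1.exists_ep
      rw [← p.co_co] at H₁
      obtain ⟨E', s', hst, H, hlt⟩ := H₂.comm H₁ hs.symm hne₂ (by
        rw [hd, Polarity.co_co, Tree.dual_dual])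
      refine ⟨_, E', s', .struct (.par_comm _ _) ?_ (.refl _), hst, H, by omega⟩
      have := Red.comm a p.co c q Q P
      rwa [Polarity.co_co] at this
    | _ => cases h₂
  | out u v P =>
    cases h₁
    obtain ⟨hsc, α, β, S, T, e₁⟩ := H₁.out_type hne
    obtain ⟨c, q, rfl⟩ := hsc.exists_ep
    cases t₂ with
    | inp u Q =>
      cases h₂
      obtain ⟨E', s', hst, H, hlt⟩ := H₁.comm H₂ hs hne hd
      exact ⟨_, E', s', Red.comm a p c q P Q, hst, H, hlt⟩
    | out u v Q =>
      cases h₂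
      obtain ⟨_, _, _, _, _, e₂⟩ := H₂.out_type hne₂
      rw [e₁, e₂, Tree.dual_out] at hd
      exact absurd hd.symm Tree.inp_ne_out
    | _ => cases h₂
  | _ => cases h₁

/-! ### Progress -/

/-- In the environment `E` the endpoint `a^p` is used but its peer is not, and the peers of all other
endpoints whose capability is below the obligation of `a^p` are available. -/
structure Ready (E : SEnv) (a : ℕ) (p : Polarity) : Prop where
  var : ∀ x, E (.var x) = .fin
  co : E (.ep a p.co) = .fin
  -- The thread waiting for `a^p` may itself hold peers, but their obligations exceed its
  -- capability, which is the obligation of `a^p`. So only peers of endpoints with high capability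
  -- can be missing.
  dual : ∀ b q, Name.ep b q ≠ .ep a p → (E (.ep b q)).cap < (E (.ep a p)).obl →
    E (.ep b q.co) = (E (.ep b q)).dual

theorem Ready.pushChan {E : SEnv} {a : ℕ} {p : Polarity} (h : Ready E a p) (T : Tree) :
    Ready (E.pushChan T) (a + 1) p := by
  refine ⟨h.var, h.co, fun b q hne hlt => ?_⟩
  cases b with
  | zero => exact SEnv.pushChan_co T E q
  | succ b => exact h.dual b q (fun e => hne (by cases e; rfl)) hlt

theorem Ready.ext {E E' : SEnv} {a m : ℕ} {p : Polarity} (h : Ready E a p) (he : Ext m E E') :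
    Ready E' (a + m) p := by
  induction he generalizing a with
  | zero E => exact h
  | @succ m E E' T _ ih =>
    rw [show a + (m + 1) = a + 1 + m by omega]
    exact ih (h.pushChan T)

/-- Channel `a` cannot take part in an exchange because one of its endpoints is unusable; any other
channel ends up with dual types. -/
theorem Ready.step {E E' : SEnv} {a : ℕ} {p : Polarity} (h : Ready E a p) (hs : Step E E') :
    Ready E' a p ∧ E' (.ep a p) = E (.ep a p) := by
  rcases hs with rfl | ⟨c, r, α, β, S, T, h₁, h₂, rfl⟩
  · exact ⟨h, rfl⟩
  have h₁' : E (.ep c r) ≠ .fin := by rw [h₁]; exact Tree.out_ne_fin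
  have h₂' : E (.ep c r.co) ≠ .fin := by rw [h₂]; exact Tree.inp_ne_fin
  have hca : c ≠ a := by
    rintro rfl
    rcases Polarity.eq_or_eq_co r p.co with e | e
    · exact h₁' (e ▸ h.co)
    · exact h₂' (e ▸ h.co)
  have key : ∀ b q, b ≠ c → Function.update (Function.update E (.ep c r) T) (.ep c r.co) T.dual
      (.ep b q) = E (.ep b q) := by
    intro b q hb; simp [hb]
  refine ⟨⟨fun x => by simpa using h.var x, ?_, fun b q hne hlt => ?_⟩, key _ _ hca.symm⟩
  · rw [key _ _ hca.symm]; exact h.co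
  · by_cases hb : b = c
    · subst hb
      rcases Polarity.eq_or_eq_co r q with rfl | rfl <;> simp
    · rw [key _ _ hca.symm, key _ _ hb] at hlt
      rw [key _ _ hb, key _ _ hb]
      exact h.dual b q hne hlt

/-- If a prefix on `c^r` is waiting, then the rest of the system has the peer of `c^r`. -/
theorem Ready.of_split {E₁ E₂ E : SEnv} {c β : ℕ} {r : Polarity} (hs : Split E₁ E₂ E)
    (hvar : ∀ x, E (.var x) = .fin) (hne : E₁ (.ep c r) ≠ .fin) (hβ : (E₁ (.ep c r)).cap = β)
    (ho : ∀ v, v ≠ .ep c r → (β : ℕ∞) < (E₁ v).obl)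
    (hd : E (.ep c r.co) = (E (.ep c r)).dual)
    (hE : ∀ b q, E₁ (.ep b q) = .fin → (E (.ep b q)).cap < β →
      E (.ep b q.co) = (E (.ep b q)).dual) :
    Ready E₂ c r.co ∧ E₂ (.ep c r.co) = (E₁ (.ep c r)).dual := by
  rw [hs.left_eq hne] at hd
  -- The peer has obligation exactly `β`, whereas all other endpoints held by the prefix have
  -- obligation above `β`.
  have h₁ : E₁ (.ep c r.co) = .fin := by
    by_contra h₁
    have := ho (.ep c r.co) (by simp)
    rw [← hs.left_eq h₁, hd, Tree.obl_dual, hβ] at this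
    exact lt_irrefl _ this
  rw [hs.eq_right h₁] at hd
  refine ⟨⟨fun x => hs.symm.left_of_eq_fin (hvar x), ?_, fun b q hbq hlt => ?_⟩, hd⟩
  · rw [Polarity.co_co]; exact hs.right_eq_fin hne
  · rw [hd, Tree.obl_dual, hβ] at hlt
    have hn : E₂ (.ep b q) ≠ .fin := by
      intro h; rw [h, Tree.cap_fin] at hlt; exact not_top_lt hlt
    have hdual := hE b q (hs.symm.right_eq_fin hn) (by rwa [hs.symm.left_eq hn])
    rw [hs.symm.left_eq hn] at hdual
    -- The peer of `b^q` has obligation below `β`, too low to be held by the prefix.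
    have h₁' : E₁ (.ep b q.co) = .fin := by
      by_contra h₁'
      have := ho (.ep b q.co) (by
        intro e; cases e; exact hbq (by rw [Polarity.co_co]))
      rw [← hs.left_eq h₁', hdual, Tree.obl_dual] at this
      exact lt_asymm this hlt
    rw [← hs.eq_right h₁', hdual]

theorem WT.red_news {s m : ℕ} {E E' E'' : SEnv} {Q X X' : Proc}
    (hc : StructCong Q (X.news m)) (he : Ext m E E') (hr : Red X X') (hs : Step E' E'')
    (H : WT 0 0 s E'' X') : ∃ Q' F, Red Q Q' ∧ Step E F ∧ WT 0 0 s F Q' := by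
  obtain ⟨F, hF, hs'⟩ := he.step hs
  exact ⟨_, F, .struct hc (hr.news m) (.refl _), hs', H.news hF⟩

/-- An endpoint with a finite obligation is exposed, or some reduction makes progress towards it. -/
theorem WT.descent (b : ℕ) : ∀ {s E Q a p}, WT 0 0 s E Q → Ready E a p →
    (E (.ep a p)).obl = b →
    (∃ m t R, Located 0 0 s E Q a p m t R ∧ t.subject = some (.ep (a + m) p)) ∨
      ∃ Q' E' s', Red Q Q' ∧ Step E E' ∧ WT 0 0 s' E' Q' ∧ s' < s := by
  induction b using Nat.strong_induction_on with
  | _ b IH =>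
  intro s E Q a p H hR hb
  have hne : E (.ep a p) ≠ .fin := by
    intro h; rw [h, Tree.obl_fin] at hb; exact ENat.top_ne_natCast b hb
  obtain ⟨m, t, R, ht, hL⟩ := H.exists_located hne
  have hL' := hL
  obtain ⟨E', E₁, E₂, s₁, s₂, hc, he, hs, H₁, H₂, rfl, hne₁⟩ := hL'
  have hR' := hR.ext he
  have hb' : (E₁ (.ep (a + m) p)).obl = b := by
    rw [← hs.left_eq hne₁, he.apply_ep, hb]
  have hvar₁ : ∀ x, E₁ (.var x) = .fin := fun x => hs.left_of_eq_fin (hR'.var x)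
  by_cases hsub : ∃ u, t.subject = some u
  · obtain ⟨u, hu⟩ := hsub
    obtain ⟨c, r, β, rfl, hne_u, hβ, ho⟩ := H₁.prefix_inv hu hvar₁ hne₁
    by_cases huv : Name.ep c r = .ep (a + m) p
    · exact .inl ⟨m, t, R, hL, by rw [hu, huv]⟩
    right
    -- The thread holds `a^p` while waiting on another endpoint, so the priority strictly decreases.
    have hβb : (β : ℕ∞) < b := hb' ▸ ho _ (Ne.symm huv)
    have hE'obl : (E' (.ep (a + m) p)).obl = b := by rw [he.apply_ep, hb]
    obtain ⟨hR₂, hd⟩ := Ready.of_split hs hR'.var hne_u hβ ho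
      (hR'.dual c r huv (by rw [hs.left_eq hne_u, hβ, hE'obl]; exact hβb))
      (fun b' q h₁ hlt => hR'.dual b' q (fun e => hne₁ (e ▸ h₁))
        (by rw [hE'obl]; exact hlt.trans hβb))
    -- The rest `R` is ready for the endpoint that the thread waits for, whose obligation is `β`.
    rcases IH β (by exact_mod_cast hβb) H₂ hR₂ (by rw [hd, Tree.obl_dual, hβ]) with
      ⟨m', t', R', ⟨E₂', F₁, F₂, r₁, r₂, hc', he', hs', H₁', H₂', rfl, hne'⟩, hu'⟩ |
      ⟨R', E₂', s', hred, hst, H', hlt⟩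
    -- The awaited prefix is exposed in `R`: extrude its `m'` restrictions over `t`, regroup so that
    -- the two prefixes are adjacent, and let them communicate.
    · obtain ⟨F, E₁', heF, he₁, hsF, hsh⟩ := he'.split hs.symm
      obtain ⟨G, hG, hG'⟩ := hsF.symm.assoc hs'
      obtain ⟨X, G', s', hred, hst, HX, hlt⟩ := (hsh H₁).comm_prefix H₁' hG
        (Proc.subject_shiftChans hu m') hu' (by rwa [he₁.apply_ep])
        (by rw [he₁.apply_ep, ← hs'.left_eq hne', he'.apply_ep, hd])
      obtain ⟨F', hsF', hstF⟩ := hst.split hG'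
      have hc'' : StructCong (.par t R)
          ((Proc.par (.par (t.shiftChans m') t') R').news m') :=
        ((StructCong.par_comm _ _).trans (.par hc' (.refl _))).trans
          ((StructCong.news_par m' _ _).trans (StructCong.news
            ((StructCong.par_comm _ _).trans (.par_assoc _ _ _)) m'))
      obtain ⟨Y, K, hredY, hstY, HY⟩ := WT.red_news hc'' heF (.par R' hred) hstF
        (.par hsF' HX H₂')
      obtain ⟨Q', K', hredQ, hstQ, HQ⟩ := WT.red_news hc he hredY hstY HY
      exact ⟨Q', K', _, hredQ, hstQ, HQ, by omega⟩
    · obtain ⟨F, hsF, hstF⟩ := hst.split hs.symm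
      obtain ⟨Q', K, hredQ, hstQ, HQ⟩ := WT.red_news hc he (hred.par_right t) hstF
        (.par hsF.symm H₁ H')
      exact ⟨Q', K, _, hredQ, hstQ, HQ, by omega⟩
  -- A thread without a subject is a recursion. Unfolding it removes one rule from the derivation,
  -- at no cost in budget `0`.
  · right
    cases H₁ with
    | garbage _ h => exact absurd (h _) hne₁
    | @recur _ _ s₁ _ P₀ H₁ =>
      have hred : Red (.recur ⊤ P₀) (P₀.instProc (.recur ⊤ P₀)) := by
        simpa using Red.recur ⊤ P₀
      obtain ⟨Q', K, hredQ, hstQ, HQ⟩ := WT.red_news hc he (.par R hred) (.inl rfl)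
        (.par hs H₁ H₂)
      exact ⟨Q', K, _, hredQ, hstQ, HQ, by omega⟩
    | inp => exact absurd ⟨_, rfl⟩ hsub
    | out => exact absurd ⟨_, rfl⟩ hsub
    | out_fin => exact absurd ⟨_, rfl⟩ hsub
    | _ => exact ht.elim

theorem Reaches.head {P P' Q : Proc} (h : Red P P') (h' : Reaches P' Q) : Reaches P Q := by
  obtain ⟨R, hR, hc⟩ := h'
  exact ⟨R, .head h hR, hc⟩

/-- Each reduction from `WT.descent` decreases the size, and `Ready.step` shows that it preserves
the type of `a^p`. The type is kept in the conclusion because it decides between input and output.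
-/
theorem WT.reaches_prefix {T : Tree} {b : ℕ} (hT : T.obl = b) (s : ℕ) : ∀ {E Q a p},
    WT 0 0 s E Q → Ready E a p → E (.ep a p) = T →
    ∃ m t R, Reaches Q ((Proc.par t R).news m) ∧ t.subject = some (.ep (a + m) p) ∧
      ∃ E' s', WT 0 0 s' E' t ∧ E' (.ep (a + m) p) = T := by
  induction s using Nat.strong_induction_on with
  | _ s IH =>
  intro E Q a p H hR he
  rcases H.descent b hR (he ▸ hT) with
    ⟨m, t, R, ⟨E', E₁, E₂, s₁, s₂, hc, hext, hs, H₁, -, -, hne⟩, hsub⟩ |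
    ⟨Q', E', s', hred, hst, H', hlt⟩
  · exact ⟨m, t, R, ⟨Q, .refl, hc⟩, hsub, E₁, s₁, H₁, by rw [← hs.left_eq hne, hext.apply_ep, he]⟩
  · obtain ⟨hR', he'⟩ := hR.step hst
    obtain ⟨m, t, R, h, h'⟩ := IH s' hlt H' hR' (he'.trans he)
    exact ⟨m, t, R, h.head hred, h'⟩

/-- Environments of closed systems. -/
structure SEnv.Balanced (E : SEnv) : Prop where
  var : ∀ x, E (.var x) = .fin
  dual : ∀ a p, E (.ep a p.co) = (E (.ep a p)).dual

theorem SEnv.Balanced.ext {E E' : SEnv} {m : ℕ} (h : E.Balanced) (he : Ext m E E') :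
    E'.Balanced := by
  induction he with
  | zero E => exact h
  | succ T _ ih =>
    refine ih ⟨h.var, fun a p => ?_⟩
    cases a with
    | zero => exact SEnv.pushChan_co T _ p
    | succ a => exact h.dual a p

/-- In a typed closed system, the peer of a waiting prefix becomes available. -/
theorem WT.exists_peer {m₀ s a : ℕ} {p : Polarity} {t Q : Proc}
    (H : WT 0 1 s (fun _ => .fin) ((Proc.par t Q).news m₀)) (ht : t.subject = some (.ep a p)) :
    ∃ E₁ s₁ m t' R E' s', WT 0 1 s₁ E₁ t ∧ E₁ (.ep a p) ≠ .fin ∧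
      Reaches Q ((Proc.par t' R).news m) ∧ t'.subject = some (.ep (a + m) p.co) ∧
      WT 0 0 s' E' t' ∧ E' (.ep (a + m) p.co) = (E₁ (.ep a p)).dual := by
  obtain ⟨E, he, H⟩ := H.news_inv
  have hB : E.Balanced := SEnv.Balanced.ext ⟨fun _ => rfl, fun _ _ => Tree.dual_fin.symm⟩ he
  obtain ⟨E₁, E₂, s₁, s₂, rfl, hs, H₁, H₂⟩ := H.par_inv
  -- Here the budget `1` is used: the exposed prefix is not garbage.
  have hne : E₁ (.ep a p) ≠ .fin := by
    cases H₁ with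
    | inp hu => cases ht; rw [hu]; exact Tree.inp_ne_fin
    | out hu => cases ht; rw [hu]; exact Tree.out_ne_fin
    | out_fin hu => cases ht; rw [hu]; exact Tree.out_ne_fin
    | _ => cases ht
  obtain ⟨_, _, β, -, -, hβ, ho⟩ :=
    H₁.prefix_inv ht (fun x => hs.left_of_eq_fin (hB.var x)) hne
  -- In a closed system every endpoint has a dual peer, so the bounds on capabilities are not
  -- needed.
  obtain ⟨hR, hd⟩ := Ready.of_split hs hB.var hne hβ ho (hB.dual a p) fun b q _ _ => hB.dual b q
  obtain ⟨m, t', R, h, hsub, E', s', H', hE'⟩ :=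
    WT.reaches_prefix (by rw [Tree.obl_dual, hβ]) s₂ (H₂.mono 0 (by omega)) hR hd
  exact ⟨E₁, s₁, m, t', R, E', s', H₁, hne, h, hsub, H', hE'⟩

/-- All budgets are carried together because each reduction spends one. The environment stays
unusable, since an exchange would need a usable free endpoint. -/
theorem WT.reaches {P Q : Proc} (h : Reaches P Q)
    (H : ∀ n, ∃ s, WT 0 n s (fun _ => .fin) P) : ∀ n, ∃ s, WT 0 n s (fun _ => .fin) Q := by
  obtain ⟨P', hr, hc⟩ := h
  suffices ∀ n, ∃ s, WT 0 n s (fun _ => .fin) P' from fun n => by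
    obtain ⟨s, H⟩ := this n
    exact ⟨s, H.structCong hc⟩
  clear hc
  induction hr with
  | refl => exact H
  | tail _ hr ih =>
    intro n
    obtain ⟨s, H⟩ := ih (n + 1)
    obtain ⟨E', s', hst, H'⟩ := H.red hr fun _ _ h _ => absurd rfl h
    rcases hst with rfl | ⟨_, _, _, _, _, _, h, _⟩
    · exact ⟨s', H'⟩
    · exact absurd h.symm Tree.out_ne_fin

theorem WT.hasProgress {P : Proc} (H : ∀ n, ∃ s, WT 0 n s (fun _ => .fin) P) : P.HasProgress := by
  constructor
  · intro n a p c q P' Q h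
    obtain ⟨s, H⟩ := WT.reaches h H 1
    obtain ⟨E₁, s₁, m, t, R, E', s', H₁, hne, hr, hsub, H', hd⟩ := H.exists_peer rfl
    obtain ⟨-, α, β, S, T, e⟩ := H₁.out_type hne
    rw [e, Tree.dual_out] at hd
    cases t with
    | inp u Q' => cases hsub; exact ⟨m, Q', R, hr⟩
    | out u v Q' =>
      cases hsub
      obtain ⟨-, _, _, _, _, e'⟩ := H'.out_type (by rw [hd]; exact Tree.inp_ne_fin)
      exact absurd (hd.symm.trans e') Tree.inp_ne_out
    | _ => cases hsub
  · intro n a p P' Q h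
    obtain ⟨s, H⟩ := WT.reaches h H 1
    obtain ⟨E₁, s₁, m, t, R, E', s', H₁, hne, hr, hsub, H', hd⟩ := H.exists_peer rfl
    obtain ⟨α, β, S, T, e⟩ := H₁.inp_type hne
    rw [e, Tree.dual_inp] at hd
    cases t with
    | inp u Q' =>
      cases hsub
      obtain ⟨_, _, _, _, e'⟩ := H'.inp_type (by rw [hd]; exact Tree.out_ne_fin)
      exact absurd (e'.symm.trans hd) Tree.inp_ne_out
    | out u v Q' =>
      cases hsub
      obtain ⟨c, q, rfl⟩ := (H'.out_type (by rw [hd]; exact Tree.out_ne_fin)).1.exists_ep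
      exact ⟨m, c, q, Q', R, hr⟩
    | _ => cases hsub

/-! ### Unfolding session types -/

/-- Agreement of two types up to depth `k`. -/
def Tree.Agree (k : ℕ) (S T : Tree) : Prop := ∀ p : List Bool, p.length < k → S p = T p

theorem Tree.Agree.refl (k : ℕ) (S : Tree) : Agree k S S := fun _ _ => rfl

theorem Tree.Agree.mono {k l : ℕ} {S T : Tree} (h : Agree l S T) (hk : k ≤ l) : Agree k S T :=
  fun p hp => h p (hp.trans_le hk)

theorem Tree.Agree.node {k : ℕ} {S T S' T' : Tree} (l : Label) (hS : Agree k S S')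
    (hT : Agree k T T') : Agree (k + 1) (node l S T) (node l S' T') := by
  intro p hp
  match p with
  | [] => rfl
  | false :: p => exact hS p (Nat.lt_of_succ_lt_succ hp)
  | true :: p => exact hT p (Nat.lt_of_succ_lt_succ hp)

theorem Tree.Agree.iterate {k : ℕ} {F G : Tree → Tree}
    (h : ∀ {x y}, Agree k x y → Agree k (F x) (G y)) (m : ℕ) :
    Agree k (F^[m] fin) (G^[m] fin) := by
  induction m with
  | zero => exact .refl _ _
  | succ m ih => rw [Function.iterate_succ_apply', Function.iterate_succ_apply']; exact h ih

/-- A valuation of type variables, extended under a recursion. -/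
def consVal (x : Tree) (ρ : ℕ → Tree) : ℕ → Tree
  | 0 => x
  | t + 1 => ρ t

/-- Unfold `rec^ι t.T`, where `F` is the meaning of `T`.  A finite index `ι` means `ι + n` unfoldings
before the end; `rec^∞ t.T` is unfolded as often as needed. -/
def Tree.fix (n : ℕ) (ι : ℕ∞) (F : Tree → Tree) : Tree :=
  -- Each iteration of a contractive map settles one more level, so `p.length + 1` iterations settle
  -- the label at `p`.
  fun p => F^[if ι = ⊤ then p.length + 1 else ι.toNat + n] fin p

/-- The meaning of a session type. -/
def Ty.interp (n : ℕ) : Ty → (ℕ → Tree) → Tree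
  | .fin, _ => .fin
  | .var t, ρ => ρ t
  | .inp α β S T, ρ => .inp α β (S.interp n ρ) (T.interp n ρ)
  | .out α β S T, ρ => .out α β (S.interp n ρ) (T.interp n ρ)
  | .mu ι T, ρ => Tree.fix n ι fun x => T.interp n (consVal x ρ)

theorem Ty.interp_agree (n : ℕ) (T : Ty) {k : ℕ} {ρ ρ' : ℕ → Tree}
    (h : ∀ t, Tree.Agree k (ρ t) (ρ' t)) : Tree.Agree k (T.interp n ρ) (T.interp n ρ') := by
  induction T generalizing ρ ρ' with
  | fin => exact .refl _ _
  | var t => exact h t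
  | inp α β S T ihS ihT => exact (Tree.Agree.node _ (ihS h) (ihT h)).mono (Nat.le_succ k)
  | out α β S T ihS ihT => exact (Tree.Agree.node _ (ihS h) (ihT h)).mono (Nat.le_succ k)
  | mu ι T ih =>
    intro p hp
    refine Tree.Agree.iterate (fun {x y} hxy => ih ?_) _ p hp
    rintro (_ | t)
    · exact hxy
    · exact h t

/-- A guarded occurrence of the variable `j` lies below an action, which gains one level of
agreement. -/
theorem Ty.interp_agree_of_guarded (n : ℕ) (T : Ty) {j k : ℕ} {ρ ρ' : ℕ → Tree}
    (hT : ¬ T.Unguarded j) (hj : Tree.Agree k (ρ j) (ρ' j))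
    (h : ∀ t, t ≠ j → Tree.Agree (k + 1) (ρ t) (ρ' t)) :
    Tree.Agree (k + 1) (T.interp n ρ) (T.interp n ρ') := by
  have hk : ∀ t, Tree.Agree k (ρ t) (ρ' t) := by
    intro t
    by_cases ht : t = j
    · exact ht ▸ hj
    · exact (h t ht).mono (Nat.le_succ k)
  induction T generalizing j ρ ρ' with
  | fin => exact .refl _ _
  | var t => exact h t hT
  | inp α β S T _ _ => exact .node _ (S.interp_agree n hk) (T.interp_agree n hk)
  | out α β S T _ _ => exact .node _ (S.interp_agree n hk) (T.interp_agree n hk)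
  | mu ι T ih =>
    intro p hp
    refine Tree.Agree.iterate (fun {x y} hxy => ih (j := j + 1) hT hj ?_ ?_) _ p hp
    · rintro (_ | t) ht
      · exact hxy
      · exact h t fun e => ht (e ▸ rfl)
    · rintro (_ | t)
      · exact hxy.mono (Nat.le_succ k)
      · exact hk t

/-- A type that is not contractive in a variable means this variable or `end`. -/
theorem Ty.interp_of_unguarded (n : ℕ) (T : Ty) {j : ℕ} (hT : T.Unguarded j) :
    (∀ ρ, T.interp n ρ = ρ j) ∨ ∀ ρ, T.interp n ρ = .fin := by
  induction T generalizing j with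
  | fin => exact hT.elim
  | var t => exact .inl fun ρ => congrArg ρ hT
  | inp α β S T _ _ => exact hT.elim
  | out α β S T _ _ => exact hT.elim
  | mu ι T ih =>
    have fin_case : ∀ (F : Tree → Tree), (∀ x, F x = .fin) → Tree.fix n ι F = .fin := by
      intro F hF
      funext p
      simp only [Tree.fix]
      generalize (if ι = ⊤ then p.length + 1 else ι.toNat + n) = m
      cases m with
      | zero => rfl
      | succ m => rw [Function.iterate_succ_apply', hF]
    rcases ih hT with h | h
    · by_cases h0 : ι = ⊤ ∨ 0 < ι.toNat + n
      · refine .inl fun ρ => funext fun p => ?_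
        simp only [Ty.interp, Tree.fix]
        obtain ⟨m, hm⟩ : ∃ m, (if ι = ⊤ then p.length + 1 else ι.toNat + n) = m + 1 := by
          split_ifs with hι
          · exact ⟨_, rfl⟩
          · exact ⟨_, (Nat.succ_pred_eq_of_pos (h0.resolve_left hι)).symm⟩
        rw [hm, Function.iterate_succ_apply', h]
        rfl
      · push Not at h0
        refine .inr fun ρ => funext fun p => ?_
        simp only [Ty.interp, Tree.fix]
        rw [if_neg h0.1, Nat.le_zero.mp h0.2]
        rfl
    · exact .inr fun ρ => fin_case _ fun x => h _

theorem Tree.fix_natCast (n m : ℕ) (F : Tree → Tree) : fix n m F = F^[m + n] fin := by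
  funext p; simp [fix]

theorem Tree.fix_top_apply (n : ℕ) (F : Tree → Tree) (p : List Bool) :
    fix n ⊤ F p = F^[p.length + 1] fin p := by
  simp [fix]

/-- All iterates from the `k`-th on agree up to depth `k`, so the diagonal choice of iterates is a
fixed point. -/
theorem Tree.fix_top_of_contractive (n : ℕ) {F : Tree → Tree}
    (hF : ∀ {k x y}, Agree k x y → Agree (k + 1) (F x) (F y)) : fix n ⊤ F = F (fix n ⊤ F) := by
  have hstab : ∀ k m l, k ≤ m → k ≤ l → Agree k (F^[m] fin) (F^[l] fin) := by
    intro k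
    induction k with
    | zero => exact fun _ _ _ _ p hp => absurd hp (Nat.not_lt_zero _)
    | succ k ih =>
      rintro (_ | m) (_ | l) hm hl
      any_goals omega
      rw [Function.iterate_succ_apply', Function.iterate_succ_apply']
      exact hF (ih _ _ (by omega) (by omega))
  funext p
  rw [fix_top_apply, Function.iterate_succ_apply']
  refine hF (k := p.length) (fun q hq => ?_) p (Nat.lt_succ_self _)
  rw [fix_top_apply]
  exact hstab (q.length + 1) _ _ (by omega) (by omega) q (Nat.lt_succ_self _)

theorem Tree.fix_top_of_const (n : ℕ) {F : Tree → Tree} (hF : ∀ x, F x = fin) :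
    fix n ⊤ F = F (fix n ⊤ F) := by
  rw [hF]
  funext p
  rw [fix_top_apply, Function.iterate_succ_apply', hF]

/-- A finite index adds one iteration; `∞` gives a fixed point. Contractivity is not assumed,
because the types inside a duality derivation need not be well formed; the degenerate bodies act as
the identity or as the constant `end`. -/
theorem Ty.interp_mu_succ (n : ℕ) (ι : ℕ∞) (T : Ty) (ρ : ℕ → Tree) :
    (Ty.mu (ι + 1) T).interp n ρ = T.interp n (consVal ((Ty.mu ι T).interp n ρ) ρ) := by
  simp only [Ty.interp]
  generalize hF : (fun x => T.interp n (consVal x ρ)) = F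
  have hF' : ∀ x, T.interp n (consVal x ρ) = F x := fun x => congrFun hF x
  rw [hF']
  by_cases hι : ι = ⊤
  · subst hι
    rw [top_add]
    by_cases hT : T.Unguarded 0
    · rcases T.interp_of_unguarded n hT with h | h
      · exact ((hF' _).symm.trans (h _)).symm
      · exact Tree.fix_top_of_const n fun x => (hF' x).symm.trans (h _)
    · refine Tree.fix_top_of_contractive n fun {k x y} hxy => ?_
      rw [← hF', ← hF']
      refine T.interp_agree_of_guarded n hT hxy ?_
      rintro (_ | t) ht
      · exact absurd rfl ht
      · exact .refl _ _
  · lift ι to ℕ using hι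
    have := Tree.fix_natCast n (ι + 1) F
    push_cast at this
    rw [this, Tree.fix_natCast, Nat.add_right_comm, Function.iterate_succ_apply']

theorem consVal_comp_liftRen (x : Tree) (ρ : ℕ → Tree) (f : ℕ → ℕ) :
    consVal x ρ ∘ liftRen f = consVal x (ρ ∘ f) := by
  funext t; cases t <;> rfl

theorem Ty.interp_rename (n : ℕ) (T : Ty) (f : ℕ → ℕ) (ρ : ℕ → Tree) :
    (T.rename f).interp n ρ = T.interp n (ρ ∘ f) := by
  induction T generalizing f ρ with
  | fin => rfl
  | var t => rfl
  | inp α β S T ihS ihT => simp only [Ty.rename, Ty.interp, ihS, ihT]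
  | out α β S T ihS ihT => simp only [Ty.rename, Ty.interp, ihS, ihT]
  | mu ι T ih => simp only [Ty.rename, Ty.interp, ih, consVal_comp_liftRen]

theorem Ty.interp_subst (n : ℕ) (T : Ty) (σ : ℕ → Ty) (ρ : ℕ → Tree) :
    (T.subst σ).interp n ρ = T.interp n fun t => (σ t).interp n ρ := by
  induction T generalizing σ ρ with
  | fin => rfl
  | var t => rfl
  | inp α β S T ihS ihT => simp only [Ty.subst, Ty.interp, ihS, ihT]
  | out α β S T ihS ihT => simp only [Ty.subst, Ty.interp, ihS, ihT]
  | mu ι T ih =>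
    simp only [Ty.subst, Ty.interp, ih]
    congr; funext x
    congr; funext t
    cases t with
    | zero => rfl
    | succ t => exact (σ t).interp_rename n _ _

theorem Ty.interp_inst (n : ℕ) (T S : Ty) (ρ : ℕ → Tree) :
    (T.inst S).interp n ρ = T.interp n (consVal (S.interp n ρ) ρ) := by
  rw [Ty.inst, Ty.interp_subst]
  congr; funext t; cases t <;> rfl

/-! ### Free type variables and stratification -/

/-- The type variable `t` is free in a type. -/
def Ty.Free : ℕ → Ty → Prop
  | _, .fin => False
  | t, .var s => s = t
  | t, .inp _ _ S T => S.Free t ∨ T.Free t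
  | t, .out _ _ S T => S.Free t ∨ T.Free t
  | t, .mu _ T => T.Free (t + 1)

/-- All message types are closed. -/
def Ty.Stratified : Ty → Prop
  | .fin => True
  | .var _ => True
  | .inp _ _ S T => (∀ t, ¬ S.Free t) ∧ S.Stratified ∧ T.Stratified
  | .out _ _ S T => (∀ t, ¬ S.Free t) ∧ S.Stratified ∧ T.Stratified
  | .mu _ T => T.Stratified

theorem Ty.interp_congr (n : ℕ) (T : Ty) {ρ ρ' : ℕ → Tree} (h : ∀ t, T.Free t → ρ t = ρ' t) :
    T.interp n ρ = T.interp n ρ' := by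
  induction T generalizing ρ ρ' with
  | fin => rfl
  | var t => exact h t rfl
  | inp α β S T ihS ihT =>
    simp only [Ty.interp]
    rw [ihS fun t ht => h t (.inl ht), ihT fun t ht => h t (.inr ht)]
  | out α β S T ihS ihT =>
    simp only [Ty.interp]
    rw [ihS fun t ht => h t (.inl ht), ihT fun t ht => h t (.inr ht)]
  | mu ι T ih =>
    simp only [Ty.interp]
    congr; funext x
    refine ih fun t ht => ?_
    cases t with
    | zero => rfl
    | succ t => exact h t ht

theorem Ty.free_rename {T : Ty} {f : ℕ → ℕ} {t : ℕ} :
    (T.rename f).Free t ↔ ∃ s, T.Free s ∧ f s = t := by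
  induction T generalizing f t with
  | fin => simp [Ty.rename, Ty.Free]
  | var s => simp [Ty.rename, Ty.Free]
  | inp α β S T ihS ihT => simp only [Ty.rename, Ty.Free, ihS, ihT, or_and_right, exists_or]
  | out α β S T ihS ihT => simp only [Ty.rename, Ty.Free, ihS, ihT, or_and_right, exists_or]
  | mu ι T ih =>
    simp only [Ty.rename, Ty.Free, ih]
    constructor
    · rintro ⟨_ | s, hs, e⟩
      · exact absurd e (Nat.succ_ne_zero _).symm
      · exact ⟨s, hs, Nat.succ_injective e⟩
    · rintro ⟨s, hs, rfl⟩
      exact ⟨s + 1, hs, rfl⟩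

theorem Ty.stratified_rename {T : Ty} {f : ℕ → ℕ} :
    (T.rename f).Stratified ↔ T.Stratified := by
  induction T generalizing f with
  | fin => rfl
  | var s => rfl
  | inp α β S T ihS ihT => simp [Ty.rename, Ty.Stratified, ihS, ihT, Ty.free_rename]
  | out α β S T ihS ihT => simp [Ty.rename, Ty.Stratified, ihS, ihT, Ty.free_rename]
  | mu ι T ih => exact ih

theorem Ty.Free.subst {T : Ty} {σ : ℕ → Ty} {s t : ℕ} (h : T.Free t) (h' : (σ t).Free s) :
    (T.subst σ).Free s := by
  induction T generalizing σ s t with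
  | fin => exact h
  | var r => exact (show r = t from h) ▸ h'
  | inp α β S T ihS ihT => exact h.imp (ihS · h') (ihT · h')
  | out α β S T ihS ihT => exact h.imp (ihS · h') (ihT · h')
  | mu ι T ih => exact ih (t := t + 1) h (Ty.free_rename.mpr ⟨s, h', rfl⟩)

theorem Ty.Stratified.of_free {T : Ty} {σ : ℕ → Ty} {t : ℕ} (h : (T.subst σ).Stratified)
    (ht : T.Free t) : (σ t).Stratified := by
  induction T generalizing σ t with
  | fin => exact ht.elim
  | var r => exact (show r = t from ht) ▸ h
  | inp α β S T ihS ihT => exact ht.elim (ihS h.2.1) (ihT h.2.2)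
  | out α β S T ihS ihT => exact ht.elim (ihS h.2.1) (ihT h.2.2)
  | mu ι T ih => exact Ty.stratified_rename.mp (ih (t := t + 1) h ht)

theorem Ty.Stratified.of_subst {T : Ty} {σ : ℕ → Ty} (h : (T.subst σ).Stratified)
    (hσ : ∀ t, T.Free t → ∃ s, σ t = .var s) : T.Stratified := by
  induction T generalizing σ with
  | fin => trivial
  | var r => trivial
  | inp α β S T ihS ihT =>
    refine ⟨fun t ht => ?_, ihS h.2.1 fun t ht => hσ t (.inl ht),
      ihT h.2.2 fun t ht => hσ t (.inr ht)⟩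
    obtain ⟨s, hs⟩ := hσ t (.inl ht)
    exact h.1 s (ht.subst (by rw [hs]; rfl))
  | out α β S T ihS ihT =>
    refine ⟨fun t ht => ?_, ihS h.2.1 fun t ht => hσ t (.inl ht),
      ihT h.2.2 fun t ht => hσ t (.inr ht)⟩
    obtain ⟨s, hs⟩ := hσ t (.inl ht)
    exact h.1 s (ht.subst (by rw [hs]; rfl))
  | mu ι T ih =>
    refine ih (σ := liftTy σ) h ?_
    rintro (_ | t) ht
    · exact ⟨0, rfl⟩
    · obtain ⟨s, hs⟩ := hσ t ht
      exact ⟨s + 1, by rw [liftTy, hs]; rfl⟩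

/-- In a duality derivation the unfolded type is the known one. Either the bound variable occurs,
and the unfolding contains the recursion itself, or the substitution only renames variables. -/
theorem Ty.Stratified.of_inst {ι κ : ℕ∞} {T : Ty} (h : (T.inst (.mu ι T)).Stratified) :
    (Ty.mu κ T).Stratified := by
  by_cases h0 : T.Free 0
  · exact Ty.Stratified.of_free (t := 0) h h0
  · refine Ty.Stratified.of_subst (T := T) h ?_
    rintro (_ | t) ht
    · exact absurd ht h0
    · exact ⟨t, rfl⟩

theorem Ty.WF.stratified_and_lt {k : ℕ} {T : Ty} (h : T.WF k) :
    T.Stratified ∧ ∀ t, T.Free t → t < k := by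
  induction T generalizing k with
  | fin => exact ⟨trivial, nofun⟩
  | var t => exact ⟨trivial, fun s hs => hs ▸ h⟩
  | inp α β S T ihS ihT =>
    obtain ⟨hS, hS'⟩ := ihS h.1
    obtain ⟨hT, hT'⟩ := ihT h.2
    have hc : ∀ t, ¬ S.Free t := fun t ht => Nat.not_lt_zero t (hS' t ht)
    exact ⟨⟨hc, hS, hT⟩, fun t ht => hT' t (ht.resolve_left (hc t))⟩
  | out α β S T ihS ihT =>
    obtain ⟨hS, hS'⟩ := ihS h.1
    obtain ⟨hT, hT'⟩ := ihT h.2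
    have hc : ∀ t, ¬ S.Free t := fun t ht => Nat.not_lt_zero t (hS' t ht)
    exact ⟨⟨hc, hS, hT⟩, fun t ht => hT' t (ht.resolve_left (hc t))⟩
  | mu ι T ih =>
    obtain ⟨hT, hT'⟩ := ih h.2
    exact ⟨hT, fun t ht => Nat.lt_of_succ_lt_succ (hT' (t + 1) ht)⟩

/-! ### Duality -/

theorem Tree.dual_fix (n : ℕ) (ι : ℕ∞) {F G : Tree → Tree} (h : ∀ x, G x.dual = (F x).dual) :
    fix n ι G = (fix n ι F).dual := by
  have key : ∀ m, G^[m] fin = (F^[m] fin).dual := by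
    intro m
    induction m with
    | zero => exact dual_fin.symm
    | succ m ih => rw [Function.iterate_succ_apply', ih, h, Function.iterate_succ_apply']
  funext p
  simp only [fix, key]
  rfl

/-- The rules for unfolding become equalities of trees. Message types are closed, so dualising the
valuation leaves them alone. -/
theorem Dual.interp {T S : Ty} (h : Dual T S) (n : ℕ) (hT : T.Stratified) (hS : S.Stratified)
    (ρ : ℕ → Tree) : S.interp n (fun t => (ρ t).dual) = (T.interp n ρ).dual := by
  induction h generalizing ρ with
  | fin => exact Tree.dual_fin.symm
  | var t => rfl
  | inp_out α β S _ ih =>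
    simp only [Ty.interp, Tree.dual_inp]
    rw [ih hT.2.2 hS.2.2, S.interp_congr n fun t ht => absurd ht (hT.1 t)]
  | out_inp α β S _ ih =>
    simp only [Ty.interp, Tree.dual_out]
    rw [ih hT.2.2 hS.2.2, S.interp_congr n fun t ht => absurd ht (hT.1 t)]
  | @mu T S ι _ ih =>
    refine Tree.dual_fix n ι fun x => ?_
    rw [← ih hT hS]
    congr; funext t; cases t <;> rfl
  | unfold_right ι _ ih =>
    rw [Ty.interp_inst, ← Ty.interp_mu_succ]
    exact ih hT hS.of_inst ρ
  | unfold_left ι _ ih =>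
    rw [Ty.interp_inst, ← Ty.interp_mu_succ]
    exact ih hT.of_inst hS ρ

/-! ### Soundness of the type system -/

/-- Cutting a recursion off with `end` can only raise its obligation, so the constraints of the
typing rules survive the interpretation. -/
theorem Ty.obl_le_obl_interp (n : ℕ) (T : Ty) {Θ : List ℕ∞} {ρ : ℕ → Tree}
    (h : ∀ t, Θ.getD t 0 ≤ (ρ t).obl) : T.obl Θ ≤ (T.interp n ρ).obl := by
  induction T generalizing Θ ρ with
  | fin => exact le_rfl
  | var t => exact h t
  | inp α β S T _ _ => exact le_rfl
  | out α β S T _ _ => exact le_rfl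
  | mu ι T ih =>
    obtain ⟨m, hm⟩ : ∃ m, ((Ty.mu ι T).interp n ρ).obl =
        ((fun x => T.interp n (consVal x ρ))^[m] Tree.fin).obl := ⟨_, rfl⟩
    rw [hm]
    cases m with
    | zero => exact le_top
    | succ m =>
      rw [Function.iterate_succ_apply']
      refine ih ?_
      rintro (_ | t)
      · exact zero_le
      · exact h t

/-- The meaning of a name environment. -/
def Env.interp (n : ℕ) (ρ : ℕ → Tree) (Δ : Env) : SEnv :=
  fun u => (Δ u).elim .fin (·.interp n ρ)

theorem Env.interp_some {n : ℕ} {ρ : ℕ → Tree} {Δ : Env} {u : Name} {T : Ty}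
    (h : Δ u = some T) : Δ.interp n ρ u = T.interp n ρ := by simp [Env.interp, h]

theorem Env.interp_none {n : ℕ} {ρ : ℕ → Tree} {Δ : Env} {u : Name}
    (h : Δ u = none) : Δ.interp n ρ u = .fin := by simp [Env.interp, h]

theorem Env.interp_add (n : ℕ) (ρ : ℕ → Tree) (Δ : Env) (u : Name) (T : Ty) :
    (Δ.add u T).interp n ρ = Function.update (Δ.interp n ρ) u (T.interp n ρ) := by
  funext v
  by_cases hv : v = u
  · subst hv; simp [Env.interp]
  · simp [Env.interp, hv]

theorem Env.interp_shiftVar (n : ℕ) (ρ : ℕ → Tree) (Δ : Env) :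
    Δ.shiftVar.interp n ρ = (Δ.interp n ρ).pushVar .fin := by
  funext u
  match u with
  | .var 0 => rfl
  | .var (x + 1) => rfl
  | .ep a p => rfl

theorem Env.interp_shiftVar_add (n : ℕ) (ρ : ℕ → Tree) (Δ : Env) (S : Ty) :
    (Δ.shiftVar.add (.var 0) S).interp n ρ = (Δ.interp n ρ).pushVar (S.interp n ρ) := by
  rw [Env.interp_add, Env.interp_shiftVar]
  funext u
  match u with
  | .var 0 => simp [SEnv.pushVar]
  | .var (x + 1) => simp [SEnv.pushVar]
  | .ep a p => simp [SEnv.pushVar]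

theorem Env.interp_shiftChan (n : ℕ) (ρ : ℕ → Tree) (Δ : Env) :
    Δ.shiftChan.interp n ρ = (Δ.interp n ρ).pushChan .fin := by
  funext u
  match u with
  | .var x => rfl
  | .ep 0 .pos => rfl
  | .ep 0 .neg => exact Tree.dual_fin.symm
  | .ep (a + 1) p => rfl

theorem Env.interp_shiftChan_add (n : ℕ) (ρ : ℕ → Tree) (Δ : Env) {T S : Ty}
    (h : S.interp n ρ = (T.interp n ρ).dual) :
    ((Δ.shiftChan.add (.ep 0 .pos) T).add (.ep 0 .neg) S).interp n ρ =
      (Δ.interp n ρ).pushChan (T.interp n ρ) := by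
  rw [Env.interp_add, Env.interp_add, Env.interp_shiftChan]
  funext u
  match u with
  | .var x => simp [SEnv.pushChan]
  | .ep 0 .pos => simp [SEnv.pushChan]
  | .ep 0 .neg => simp [SEnv.pushChan, h]
  | .ep (a + 1) p => simp [SEnv.pushChan]

theorem Env.IsComp.split {Δ₁ Δ₂ Δ : Env} (h : Env.IsComp Δ₁ Δ₂ Δ) (n : ℕ) (ρ : ℕ → Tree) :
    Split (Δ₁.interp n ρ) (Δ₂.interp n ρ) (Δ.interp n ρ) := by
  intro u
  rcases h u with ⟨h₁, h₂⟩ | ⟨h₁, h₂⟩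
  · exact .inl ⟨Env.interp_none h₁, by simp [Env.interp, h₂]⟩
  · exact .inr ⟨Env.interp_none h₁, by simp [Env.interp, h₂]⟩

theorem Env.IsComp.some_of_left {Δ₁ Δ₂ Δ : Env} (h : Env.IsComp Δ₁ Δ₂ Δ) {u : Name} {T : Ty}
    (hu : Δ₁ u = some T) : Δ u = some T := by
  rcases h u with ⟨h₁, _⟩ | ⟨_, h₂⟩
  · rw [hu] at h₁; cases h₁
  · rw [h₂, hu]

theorem Env.IsComp.some_of_right {Δ₁ Δ₂ Δ : Env} (h : Env.IsComp Δ₁ Δ₂ Δ) {u : Name} {T : Ty}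
    (hu : Δ₂ u = some T) : Δ u = some T := by
  rcases h u with ⟨_, h₂⟩ | ⟨h₁, _⟩
  · rw [h₂, hu]
  · rw [hu] at h₁; cases h₁

/-- `p` holds of all entries of an environment. -/
def Env.All (p : Name → Ty → Prop) (Δ : Env) : Prop := ∀ u T, Δ u = some T → p u T

theorem Env.all_add {p : Name → Ty → Prop} {Δ : Env} {u : Name} {T : Ty} (h : Δ u = none) :
    (Δ.add u T).All p ↔ p u T ∧ Δ.All p := by
  constructor
  · refine fun H => ⟨H u T (by simp), fun v V hv => H v V ?_⟩
    rwa [Env.add, Function.update_of_ne]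
    rintro rfl; rw [h] at hv; cases hv
  · rintro ⟨hu, H⟩ v V hv
    by_cases hvu : v = u
    · subst hvu
      simp only [Env.add, Function.update_self, Option.some.injEq] at hv
      exact hv ▸ hu
    · rw [Env.add, Function.update_of_ne hvu] at hv
      exact H v V hv

theorem Env.all_shiftVar {p : Name → Ty → Prop} {Δ : Env} :
    Δ.shiftVar.All p ↔ Δ.All fun u => p (u.subst (fun x => .var (x + 1)) id) := by
  constructor
  · intro H u T hu
    exact H _ T (by cases u <;> exact hu)
  · intro H u T hu
    match u with
    | .var 0 => cases hu
    | .var (x + 1) => exact H (.var x) T hu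
    | .ep a p => exact H (.ep a p) T hu

theorem Env.all_shiftChan {p : Name → Ty → Prop} {Δ : Env} :
    Δ.shiftChan.All p ↔ Δ.All fun u => p (u.subst .var Nat.succ) := by
  constructor
  · intro H u T hu
    exact H _ T (by cases u <;> exact hu)
  · intro H u T hu
    match u with
    | .var x => exact H (.var x) T hu
    | .ep 0 p => cases hu
    | .ep (a + 1) p => exact H (.ep a p) T hu

theorem Env.all_shiftChan_add {p : Name → Ty → Prop} {Δ : Env} {T S : Ty} :
    ((Δ.shiftChan.add (.ep 0 .pos) T).add (.ep 0 .neg) S).All p ↔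
      p (.ep 0 .neg) S ∧ p (.ep 0 .pos) T ∧ Δ.All fun u => p (u.subst .var Nat.succ) := by
  rw [Env.all_add (by simp [Env.shiftChan]), Env.all_add rfl, Env.all_shiftChan]

theorem Env.all_ofList {p : Name → Ty → Prop} {us : List Name} {T : Name → Ty} :
    (Env.ofList us T).All p ↔ ∀ u ∈ us, p u (T u) := by
  constructor
  · exact fun H u hu => H u _ (by simp [Env.ofList, hu])
  · intro H u V hu
    simp only [Env.ofList] at hu
    split_ifs at hu with h
    cases hu
    exact H u h

theorem Env.all_isComp {p : Name → Ty → Prop} {Δ₁ Δ₂ Δ : Env} (h : Env.IsComp Δ₁ Δ₂ Δ) :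
    Δ.All p ↔ Δ₁.All p ∧ Δ₂.All p := by
  constructor
  · exact fun H => ⟨fun u T hu => H u T (h.some_of_left hu),
      fun u T hu => H u T (h.some_of_right hu)⟩
  · rintro ⟨H₁, H₂⟩ u T hu
    rcases h u with ⟨_, e⟩ | ⟨_, e⟩
    · exact H₂ u T (e ▸ hu)
    · exact H₁ u T (e ▸ hu)

/-- A free type variable in the type of a name is the type of this name at some process variable. -/
theorem Typing.exists_of_free {κ : ℕ∞} {Θ : List ℕ∞} {Γ : List Env} {Δ : Env} {P : Proc}
    (H : Typing κ Θ Γ Δ P) (hΔ : Δ.All fun _ T => T.Stratified) :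
    Δ.All fun u T => ∀ t, T.Free t → ∃ Δ' ∈ Γ, Δ' u = some (.var t) := by
  induction H with
  | idle Θ Γ => exact fun _ _ h => nomatch h
  | var Θ Γ X Δ hX hvar _ =>
    intro u T hu t ht
    obtain ⟨s, _, rfl⟩ := hvar u T hu
    obtain rfl : s = t := ht
    exact ⟨Δ, List.mem_of_getElem? hX, hu⟩
  | @inp Θ Γ Δ P u α β S T hu _ _ ih =>
    rw [Env.all_add hu] at hΔ ⊢
    obtain ⟨hST, hΔ⟩ := hΔ
    have ih := ih (by
      rw [Env.all_add rfl, Env.all_shiftVar, Env.all_add hu]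
      exact ⟨hST.2.1, hST.2.2, hΔ⟩)
    rw [Env.all_add rfl, Env.all_shiftVar, Env.all_add hu] at ih
    obtain ⟨-, hT, ih⟩ := ih
    have key : ∀ (u : Name) t, (∃ Δ' ∈ Γ.map Env.shiftVar,
        Δ' (u.subst (fun x => .var (x + 1)) id) = some (.var t)) →
        ∃ Δ' ∈ Γ, Δ' u = some (.var t) := by
      rintro u t ⟨Δ', hΔ', h⟩
      obtain ⟨Δ'', hΔ'', rfl⟩ := List.mem_map.mp hΔ'
      exact ⟨Δ'', hΔ'', by cases u <;> exact h⟩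
    exact ⟨fun t ht => key _ _ (hT t (ht.resolve_left (hST.1 t))),
      fun v V hv t ht => key _ _ (ih v V hv t ht)⟩
  | @out Θ Γ Δ P u v α β S T hu hv huv _ _ _ ih =>
    have hv' : (Δ.add u (.out α β S T)) v = none := by
      rw [Env.add, Function.update_of_ne (Ne.symm huv), hv]
    rw [Env.all_add hv', Env.all_add hu] at hΔ ⊢
    obtain ⟨hS, hST, hΔ⟩ := hΔ
    have ih := ih (by rw [Env.all_add hu]; exact ⟨hST.2.2, hΔ⟩)
    rw [Env.all_add hu] at ih
    exact ⟨fun t ht => absurd ht (hST.1 t),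
      fun t ht => ih.1 t (ht.resolve_left (hST.1 t)), ih.2⟩
  | par hs _ _ ih₁ ih₂ =>
    rw [Env.all_isComp hs] at hΔ ⊢
    exact ⟨ih₁ hΔ.1, ih₂ hΔ.2⟩
  | fin u hu _ ih =>
    rw [Env.all_add hu] at hΔ ⊢
    exact ⟨fun t ht => ht.elim, ih hΔ.2⟩
  | @recur Θ Γ P ι us T _ _ _ ih =>
    rw [Env.all_ofList] at hΔ ⊢
    rw [Env.all_ofList, Env.all_ofList] at ih
    intro u hu t ht
    obtain ⟨Δ', hΔ', h⟩ := ih (fun u hu => Ty.stratified_rename.mpr (hΔ u hu)) u hu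
      (t + us.length) (Ty.free_rename.mpr ⟨t + 1, ht, rfl⟩)
    rcases List.mem_cons.mp hΔ' with rfl | hΔ'
    -- The newly bound type variables have indices below `us.length`, the shifted outer ones do not.
    · simp only [Env.ofList, if_pos hu, Option.some.injEq, Ty.var.injEq] at h
      have := List.idxOf_lt_length_iff.mpr hu
      omega
    · obtain ⟨Δ'', hΔ'', rfl⟩ := List.mem_map.mp hΔ'
      refine ⟨Δ'', hΔ'', ?_⟩
      simp only [Env.shiftTy, Option.map_eq_some_iff] at h
      obtain ⟨V, hV, h⟩ := h
      cases V <;> simp only [Ty.rename, reduceCtorEq, Ty.var.injEq] at h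
      rw [hV, Nat.add_right_cancel h]
  | @new Θ Γ Δ P T S hT hS _ _ ih =>
    have ih := ih (by
      rw [Env.all_shiftChan_add]
      exact ⟨hS.stratified_and_lt.1, hT.stratified_and_lt.1, hΔ⟩)
    rw [Env.all_shiftChan_add] at ih
    intro u V hV t ht
    obtain ⟨Δ', hΔ', h⟩ := ih.2.2 u V hV t ht
    obtain ⟨Δ'', hΔ'', rfl⟩ := List.mem_map.mp hΔ'
    exact ⟨Δ'', hΔ'', by cases u <;> exact h⟩

/-- Give the index `∞` to all recursions. -/
def Proc.toUser : Proc → Proc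
  | .idle => .idle
  | .pvar X => .pvar X
  | .inp u P => .inp u P.toUser
  | .out u w P => .out u w P.toUser
  | .par P Q => .par P.toUser Q.toUser
  | .new P => .new P.toUser
  | .recur _ P => .recur ⊤ P.toUser

theorem Proc.IsUser.toUser_approx {P : Proc} (h : P.IsUser) (κ : ℕ∞) :
    (P.approx κ).toUser = P := by
  induction P with
  | idle => rfl
  | pvar X => rfl
  | inp u P ih => simp only [Proc.approx, Proc.toUser, ih h]
  | out u w P ih => simp only [Proc.approx, Proc.toUser, ih h]
  | par P Q ihP ihQ => simp only [Proc.approx, Proc.toUser, ihP h.1, ihQ h.2]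
  | new P ih => simp only [Proc.approx, Proc.toUser, ih h]
  | recur ι P ih => simp only [Proc.approx, Proc.toUser, ih h.2, h.1]

/-- Here `n` fixes the meaning of types, `d` is the budget and `τ` gives typed processes for the
process variables. Quantifying over `ρ` and `τ` lets the body of a recursion be used at each of its
approximations. -/
theorem Typing.semantic {Θ : List ℕ∞} {Γ : List Env} {Δ : Env} {P : Proc}
    (H : Typing 0 Θ Γ Δ P) (n : ℕ) (hΔ : Δ.All fun _ T => T.Stratified) :
    ∀ {k d : ℕ} {ρ : ℕ → Tree} {τ : ℕ → Proc}, d ≤ n →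
      (∀ t, Θ.getD t 0 ≤ (ρ t).obl) →
      (Δ.All fun u _ => u.Scoped k) →
      (∀ X Δ', Γ[X]? = some Δ' → ∃ s, WT k d s (Δ'.interp n ρ) (τ X)) →
      ∃ s, WT k d s (Δ.interp n ρ) (P.toUser.subst τ) := by
  induction H with
  | idle Θ Γ => exact fun _ _ _ _ => ⟨0, .idle fun _ => rfl⟩
  | var Θ Γ X Δ hX _ _ => exact fun _ _ _ hτ => hτ X Δ hX
  | @inp Θ Γ Δ P u α β S T hu _ ho ih =>
    intro k d ρ τ hd hΘ hsc hτ
    rw [Env.all_add hu] at hΔ hsc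
    obtain ⟨hST, hΔ⟩ := hΔ
    have hshift : ∀ {u : Name}, u.Scoped k → (u.subst (fun x => .var (x + 1)) id).Scoped (k + 1) :=
      fun h => h.subst fun x hx => Nat.succ_lt_succ hx
    obtain ⟨s, H⟩ := ih (by
      rw [Env.all_add rfl, Env.all_shiftVar, Env.all_add hu]
      exact ⟨hST.2.1, hST.2.2, hΔ⟩) (k := k + 1) (τ := fun X => (τ X).shiftVar) hd hΘ (by
        rw [Env.all_add rfl, Env.all_shiftVar, Env.all_add hu]
        exact ⟨Nat.succ_pos k, hshift hsc.1, fun v V hv => hshift (hsc.2 v V hv)⟩) (by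
      intro X Δ' hX
      rw [List.getElem?_map, Option.map_eq_some_iff] at hX
      obtain ⟨Δ'', hX, rfl⟩ := hX
      obtain ⟨s, H⟩ := hτ X Δ'' hX
      refine ⟨s, ?_⟩
      rw [Env.interp_shiftVar]
      exact H.ren _ _ _ (Push.shiftVar _) fun x hx => Nat.succ_lt_succ hx)
    rw [Env.interp_shiftVar_add, Env.interp_add] at H
    refine ⟨s + 1, .inp (u := u) (α := α) (β := β) (by rw [Env.interp_add]; simp; rfl) ?_ ?_⟩
    · intro v hv
      rw [Env.interp_add, Function.update_of_ne hv]
      cases hΔv : Δ v with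
      | none => rw [Env.interp_none hΔv]; exact ENat.natCast_lt_top β
      | some V =>
        rw [Env.interp_some hΔv]
        exact (ho v V hΔv).trans_le (V.obl_le_obl_interp n hΘ)
    · rw [Env.interp_add, Function.update_idem]
      exact H
  | @out Θ Γ Δ P u v α β S T hu hv huv _ hS ho ih =>
    intro k d ρ τ hd hΘ hsc hτ
    have hv' : (Δ.add u (.out α β S T)) v = none := by
      rw [Env.add, Function.update_of_ne (Ne.symm huv), hv]
    rw [Env.all_add hv', Env.all_add hu] at hΔ hsc
    obtain ⟨s, H⟩ := ih (by rw [Env.all_add hu]; exact ⟨hΔ.2.1.2.2, hΔ.2.2⟩) hd hΘ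
      (by rw [Env.all_add hu]; exact hsc.2) hτ
    have hvΔ : Δ.interp n ρ v = .fin := Env.interp_none hv
    have hobl : ∀ w, w ≠ u → (β : ℕ∞) <
        (((Δ.add u (.out α β S T)).add v S).interp n ρ w).obl := by
      intro w hw
      rw [Env.interp_add, Env.interp_add]
      by_cases hwv : w = v
      · subst hwv
        rw [Function.update_self]
        exact hS.trans_le (S.obl_le_obl_interp n hΘ)
      rw [Function.update_of_ne hwv, Function.update_of_ne hw]
      cases hΔw : Δ w with
      | none => rw [Env.interp_none hΔw]; exact ENat.natCast_lt_top β
      | some V =>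
        rw [Env.interp_some hΔw]
        exact (ho w V hΔw).trans_le (V.obl_le_obl_interp n hΘ)
    have hu' : ((Δ.add u (.out α β S T)).add v S).interp n ρ u =
        .out α β (S.interp n ρ) (T.interp n ρ) := by
      rw [Env.interp_add, Env.interp_add, Function.update_of_ne huv, Function.update_self]; rfl
    have hE : Function.update (Function.update
        (((Δ.add u (.out α β S T)).add v S).interp n ρ) u (T.interp n ρ)) v .fin =
        (Δ.add u T).interp n ρ := by
      rw [Env.interp_add, Env.interp_add, Env.interp_add]
      funext w
      by_cases hwv : w = v
      · subst hwv; simp [Ne.symm huv, hvΔ]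
      by_cases hwu : w = u
      · subst hwu; simp [huv]
      · simp [hwv, hwu]
    -- A message type other than `end` may denote the tree `fin`, for instance a recursion cut off
    -- at once.
    by_cases hSf : S.interp n ρ = .fin
    · refine ⟨s + 1, .out_fin (by rw [hu', hSf]) hsc.1 hobl ?_⟩
      rwa [← hE, Function.update_eq_self_iff.mpr] at H
      rw [Function.update_of_ne (Ne.symm huv), Env.interp_add, Function.update_self, hSf]
    · refine ⟨s + 1, .out hu' hSf (Ne.symm huv) hsc.1 ?_ hobl (hE ▸ H)⟩
      rw [Env.interp_add, Function.update_self]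
  | par hs _ _ ih₁ ih₂ =>
    intro k d ρ τ hd hΘ hsc hτ
    rw [Env.all_isComp hs] at hΔ hsc
    obtain ⟨s₁, H₁⟩ := ih₁ hΔ.1 hd hΘ hsc.1 hτ
    obtain ⟨s₂, H₂⟩ := ih₂ hΔ.2 hd hΘ hsc.2 hτ
    exact ⟨_, .par (hs.split n ρ) H₁ H₂⟩
  | fin u hu _ ih =>
    intro k d ρ τ hd hΘ hsc hτ
    rw [Env.all_add hu] at hΔ hsc
    obtain ⟨s, H⟩ := ih hΔ.2 hd hΘ hsc.2 hτ
    refine ⟨s, ?_⟩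
    rwa [Env.interp_add, Function.update_eq_self_iff.mpr]
    rw [Env.interp_none hu]; rfl
  | @recur Θ Γ P ι us T _ hι _ ih =>
    intro k d ρ τ hd hΘ hsc hτ
    obtain rfl : ι = 0 := nonpos_iff_eq_zero.mp hι
    rw [Env.all_ofList] at hΔ hsc
    rw [Env.all_ofList] at ih
    set F : Name → Tree → Tree := fun u x => (T u).interp n (consVal x ρ) with hF
    -- The approximations of the environment and of the valuation.
    set E : ℕ → SEnv := fun j u => if u ∈ us then (F u)^[j] .fin else .fin with hE
    set V : ℕ → ℕ → Tree := fun j t =>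
      if h : t < us.length then (F us[t])^[j] .fin else ρ (t - us.length) with hV
    have hVidx : ∀ j, ∀ u ∈ us, V j (us.idxOf u) = (F u)^[j] .fin := by
      intro j u hu
      have hlt := List.idxOf_lt_length_iff.mpr hu
      simp only [hV, dif_pos hlt, List.getElem_idxOf]
    have hVadd : ∀ j t, V j (t + us.length) = ρ t := by
      intro j t
      simp [hV]
    have hobl : ∀ j t, (us.map (fun u => (Ty.mu 0 (T u)).obl Θ) ++ Θ).getD t 0 ≤ (V j t).obl := by
      intro j t
      by_cases ht : t < us.length
      · simp only [hV, dif_pos ht]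
        rw [List.getD_append _ _ _ _ (by simpa using ht), List.getD_eq_getElem _ _ (by simpa using ht),
          List.getElem_map]
        cases j with
        | zero => exact le_top
        | succ j =>
          rw [Function.iterate_succ_apply']
          refine (T us[t]).obl_le_obl_interp n ?_
          rintro (_ | t)
          · exact zero_le
          · exact hΘ t
      · simp only [hV, dif_neg ht]
        rw [List.getD_append_right _ _ _ _ (by simpa using ht), List.length_map]
        exact hΘ _
    have hEvar : ∀ j, (Env.ofList us fun u => .var (us.idxOf u)).interp n (V j) = E j := by
      intro j
      funext u
      by_cases hu : u ∈ us
      · simp only [Env.interp, Env.ofList, if_pos hu, hE]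
        exact hVidx j u hu
      · simp [Env.interp, Env.ofList, hE, hu]
    have hEbody : ∀ j, (Env.ofList us fun u =>
        (T u).openAt us.length (us.idxOf u)).interp n (V j) = E (j + 1) := by
      intro j
      funext u
      by_cases hu : u ∈ us
      · simp only [Env.interp, Env.ofList, if_pos hu, hE, Option.elim, Ty.openAt,
          Ty.interp_rename, Function.iterate_succ_apply']
        rw [← hVidx j u hu, hF]
        congr
        funext t
        cases t with
        | zero => rfl
        | succ t => exact hVadd j t
      · simp [Env.interp, Env.ofList, hE, hu]
    -- At `j = 0` no name is usable and the recursion is garbage. The step types the body with the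
    -- recursion at stage `j` in place of the process variable; unfolding adds one to the budget,
    -- and `d` caps it because of the other process variables.
    have key : ∀ j, ∃ s, WT k (min j d) s (E j) (.recur ⊤ (P.toUser.subst (liftProc τ))) := by
      intro j
      induction j with
      | zero =>
        rw [Nat.zero_min]
        exact ⟨0, .garbage _ fun u => by simp only [hE]; split_ifs <;> rfl⟩
      | succ j ihj =>
        obtain ⟨s, H⟩ := ih (fun u hu => Ty.stratified_rename.mpr (hΔ u hu)) (k := k)
          (d := min j d) (ρ := V j)
          (τ := consProc (.recur ⊤ (P.toUser.subst (liftProc τ))) τ) (by omega) (hobl j)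
          (by rw [Env.all_ofList]; exact hsc) (by
            rintro (_ | X) Δ' hX
            · obtain rfl : _ = Δ' := by simpa using hX
              rw [hEvar]
              exact ihj
            · rw [List.getElem?_cons_succ, List.getElem?_map, Option.map_eq_some_iff] at hX
              obtain ⟨Δ'', hX, rfl⟩ := hX
              obtain ⟨s, H⟩ := hτ X Δ'' hX
              refine ⟨s, ?_⟩
              have : (Δ''.shiftTy us.length).interp n (V j) = Δ''.interp n ρ := by
                funext u
                simp only [Env.interp, Env.shiftTy]
                cases Δ'' u with
                | none => rfl
                | some U =>
                  simp only [Option.map_some, Option.elim_some, Ty.interp_rename]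
                  exact congrArg (U.interp n) (funext fun t => hVadd j t)
              rw [this]
              exact H.mono _ (Nat.min_le_right _ _))
        rw [hEbody, ← Proc.subst_liftProc_instProc] at H
        exact ⟨s + 1, .recur (H.mono _ (by omega))⟩
    obtain ⟨s, H⟩ := key n
    rw [Nat.min_eq_right hd] at H
    refine ⟨s, ?_⟩
    -- The index `0` means exactly `n` iterations, the stage just reached.
    suffices h : (Env.ofList us fun u => .mu 0 (T u)).interp n ρ = E n by rw [h]; exact H
    funext u
    by_cases hu : u ∈ us
    · simp only [Env.interp, Env.ofList, if_pos hu, hE, Option.elim, Ty.interp]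
      exact (Tree.fix_natCast n 0 (F u)).trans (by rw [Nat.zero_add])
    · simp [Env.interp, Env.ofList, hE, hu]
  | @new Θ Γ Δ P T S hT hS hTS HP ih =>
    intro k d ρ τ hd hΘ hsc hτ
    have hstr : ((Δ.shiftChan.add (.ep 0 .pos) T).add (.ep 0 .neg) S).All
        fun _ T => T.Stratified := by
      rw [Env.all_shiftChan_add]
      exact ⟨hS.stratified_and_lt.1, hT.stratified_and_lt.1, hΔ⟩
    -- A free type variable would have to be the type of the bound channel at some process variable,
    -- but no environment in `Γ` mentions this channel.
    have hclosed : ∀ t, ¬ S.Free t := by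
      intro t ht
      have := HP.exists_of_free hstr
      rw [Env.all_shiftChan_add] at this
      obtain ⟨Δ', hΔ', h⟩ := this.1 t ht
      obtain ⟨Δ'', _, rfl⟩ := List.mem_map.mp hΔ'
      cases h
    have hdual : S.interp n ρ = (T.interp n ρ).dual := by
      rw [← hTS.interp n hT.stratified_and_lt.1 hS.stratified_and_lt.1 ρ]
      exact S.interp_congr n fun t ht => absurd ht (hclosed t)
    have hshift : ∀ {u : Name}, u.Scoped k → (u.subst .var Nat.succ).Scoped k :=
      fun h => h.subst fun x hx => hx
    obtain ⟨s, H⟩ := ih hstr (k := k) (τ := fun X => (τ X).shiftChan) hd hΘ (by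
        rw [Env.all_shiftChan_add]
        exact ⟨trivial, trivial, fun v V hv => hshift (hsc v V hv)⟩) (by
      intro X Δ' hX
      rw [List.getElem?_map, Option.map_eq_some_iff] at hX
      obtain ⟨Δ'', hX, rfl⟩ := hX
      obtain ⟨s, H⟩ := hτ X Δ'' hX
      exact ⟨s, Env.interp_shiftChan n ρ Δ'' ▸ H.shiftChan⟩)
    rw [Env.interp_shiftChan_add n ρ Δ hdual] at H
    exact ⟨s, .new _ H⟩

end Session

theorem mainTheorem1 (P : Session.Proc) (hP : P.IsUser)
    (hT : Session.Typing 0 [] [] Session.Env.empty (P.approx 0)) :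
    P.HasProgress := by
  refine Session.WT.hasProgress fun n => ?_
  obtain ⟨s, H⟩ := hT.semantic n (fun _ _ h => nomatch h) (k := 0) (ρ := fun _ => .fin)
    (τ := Session.Proc.pvar) le_rfl (fun _ => le_top) (fun _ _ h => nomatch h)
    (fun _ _ h => nomatch h)
  -- Restoring the index `∞` in the `0`-approximant of a user process gives the process back.
  rw [hP.toUser_approx, Session.Proc.subst_pvar] at H
  exact ⟨s, H⟩
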